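/- Let $n\ge 0$. For real polynomials $P=\sum_{i=0}^n\binom ni a_ix^i$ and $Q=\sum_{i=0}^n\binom ni b_ix^i$ let $P*Q=\sum_{i=0}^n\binom ni a_ib_ix^i$ be their Schur–Szegő composition. Let $Hyp_n$ be the set of real polynomials of degree $n$ all of whose roots are real, $Hyp_n^-\subset Hyp_n$ the subset of those with all roots negative, and $H_{u,v,w}\subset Hyp_n$ ($u+v+w=n$) the set of those with $u$ negative roots, $w$ positive roots and a $v$-fold root at $0$. Roots are counted with multiplicity; write $m_P(\alpha)$ for the multiplicity of $\alpha$ as a root of $P$, and $[\alpha]_-$ (resp. $[\alpha]_+$) for the number of roots to the left (resp. right) of a root $\alpha$ of a given polynomial; $[\beta]_{\mathrm{sign}(\alpha)}$ means $[\beta]_+$ if $\alpha>0$ and $[\beta]_-$ if $\alpha<0$. The multiplicity vector $MV_P$ of $P\in Hyp_n$ is the list of the multiplicities of its distinct roots, in increasing order of the roots. Let $P\in Hyp_n$ and $Q\in Hyp_n^-$. Call a root $\alpha$ of $P$ and a root $\beta$ of $Q$ an A-pair if $m_P(\alpha)+m_Q(\beta)>n$. The members of A-pairs are called A-roots of $P$,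 respectively of $Q$; the A-roots of $P*Q$ are the numbers $-\alpha\beta$ for A-pairs $(\alpha,\beta)$ and, if $P(0)=0$, also $0$. All other roots of $P*Q$ are called B-roots. Then: (a) If $P\in H_{u,v,w}$, then $P*Q\in H_{u,v,w}$; and if $(\alpha,\beta)$ is an A-pair with $\alpha\ne0$, then $-\alpha\beta$ is a root of $P*Q$ of multiplicity $m_P(\alpha)+m_Q(\beta)-n$. (i) For any A-root $\alpha\neq0$ of $P$ and any A-root $\beta$ of $Q$ one has $[-\alpha\beta]_-=[\alpha]_-+[\beta]_{\mathrm{sign}(\alpha)}$, where the three terms refer to $P*Q$, $P$ and $Q$ respectively. (ii) Every B-root of $P*Q$ is simple. Moreover, (a), (i) and (ii) determine $MV_{P*Q}$ uniquely: every polynomial $R$ that satisfies (a), (i) and (ii) in place of $P*Q$ (with B-roots of $R$ meaning the roots of $R$ that are not among the A-roots listed above) has $MV_R=MV_{P*Q}$. In particular $MV_{P*Q}$ depends only on $MV_P$, on $MV_Q$ and on the triple $(u,v,w)$ with $P\in H_{u,v,w}$: if also $P'\in H_{u,v,w}$ and $Q'\in Hyp_n^-$ with $MV_{P'}=MV_P$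 and $MV_{Q'}=MV_Q$, then $MV_{P'*Q'}=MV_{P*Q}$. -/

import Mathlib

open Polynomial

namespace SchurSzego

noncomputable section

/-- The `i`-th term `a i` of the diagonal sequence of `P = ∑ i ≤ n, (n choose i) * a i * x ^ i`. -/
def diagSeq (n : ℕ) (P : ℝ[X]) (i : ℕ) : ℝ :=
  P.coeff i / (n.choose i : ℝ)

/-- The Schur-Szegő composition `P ∗ Q = ∑ i ≤ n, (n choose i) * a i * b i * x ^ i` of two
polynomials of degree at most `n` with diagonal sequences `a` and `b`. -/
def comp (n : ℕ) (P Q : ℝ[X]) : ℝ[X] :=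
  ∑ i ∈ Finset.range (n + 1), monomial i ((n.choose i : ℝ) * (diagSeq n P i * diagSeq n Q i))

/-- Hyperbolic polynomials of degree `n`: all `n` roots (with multiplicity) are real, that is,
the polynomial is a product of linear factors over `ℝ`. The zero polynomial is excluded. -/
def Hyp (n : ℕ) (P : ℝ[X]) : Prop :=
  P.degree = (n : WithBot ℕ) ∧ P.Splits

/-- Hyperbolic polynomials of degree `n` all of whose roots are negative. -/
def HypNeg (n : ℕ) (P : ℝ[X]) : Prop :=
  Hyp n P ∧ ∀ x : ℝ, P.IsRoot x → x < 0

/-- `[x]_-`: the number of roots of `P`, with multiplicity, to the left of `x`. -/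
def rootsLeft (P : ℝ[X]) (x : ℝ) : ℕ := P.roots.countP (· < x)

/-- `[x]_+`: the number of roots of `P`, with multiplicity, to the right of `x`. -/
def rootsRight (P : ℝ[X]) (x : ℝ) : ℕ := P.roots.countP (x < ·)

/-- `[x]_s` for a sign `s`: `[x]_+` if `s` is positive and `[x]_-` if `s` is negative. The value
for `s = 0` is a convention that is never used. -/
def rootsSide (P : ℝ[X]) (s : SignType) (x : ℝ) : ℕ :=
  match s with
  | SignType.pos => rootsRight P x
  | SignType.neg => rootsLeft P x
  | SignType.zero => 0

/-- The class `H_{u,v,w}`: hyperbolic polynomials of degree `n` with `u` negative roots, `w`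
positive roots (with multiplicity) and a `v`-fold root at `0`. -/
def MemH (n u v w : ℕ) (P : ℝ[X]) : Prop :=
  Hyp n P ∧ rootsLeft P 0 = u ∧ P.rootMultiplicity 0 = v ∧ rootsRight P 0 = w

/-- The multiplicity vector: the multiplicities of the distinct roots, in the increasing order
of the roots. -/
def multVector (P : ℝ[X]) : List ℕ :=
  (P.roots.toFinset.sort (· ≤ ·)).map fun x => P.rootMultiplicity x

/-- `α` is a root of `P`, `β` is a root of `Q`, and their multiplicities add up to more
than `n`. -/
def IsAPair (n : ℕ) (P Q : ℝ[X]) (α β : ℝ) : Prop :=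
  P.IsRoot α ∧ Q.IsRoot β ∧ n < P.rootMultiplicity α + Q.rootMultiplicity β

/-- `α` is an A-root of the first factor `P` of the pair `(P, Q)`. -/
def IsARootFst (n : ℕ) (P Q : ℝ[X]) (α : ℝ) : Prop := ∃ β : ℝ, IsAPair n P Q α β

/-- `β` is an A-root of the second factor `Q` of the pair `(P, Q)`. -/
def IsARootSnd (n : ℕ) (P Q : ℝ[X]) (β : ℝ) : Prop := ∃ α : ℝ, IsAPair n P Q α β

/-- The locations of the A-roots of the composition: the numbers `-αβ` for the A-pairs `(α, β)`,
and also `0` if `0` is a root of `P`. -/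
def IsALocation (n : ℕ) (P Q : ℝ[X]) (x : ℝ) : Prop :=
  (∃ α β : ℝ, IsAPair n P Q α β ∧ x = -(α * β)) ∨ (x = 0 ∧ P.IsRoot 0)

/-- `x` is a B-root of `R` (in the role of `P ∗ Q`): a root that is not an A-root. -/
def IsBRoot (n : ℕ) (P Q R : ℝ[X]) (x : ℝ) : Prop :=
  R.IsRoot x ∧ ¬ IsALocation n P Q x

/-- The rules that relate the roots of `R` (in the role of `P ∗ Q`) to those of `P` and `Q`. -/
structure Rules (n : ℕ) (P Q R : ℝ[X]) : Prop where
  /-- `R` has the same numbers of negative, zero and positive roots as `P`. -/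
  signs : ∀ u v w : ℕ, MemH n u v w P → MemH n u v w R
  /-- An A-pair `(α, β)` with `α ≠ 0` gives the root `-αβ` of `R`, of multiplicity equal to the
  sum of the multiplicities of `α` and `β` minus `n` (which is positive). -/
  mult : ∀ α β : ℝ, α ≠ 0 → IsAPair n P Q α β →
    R.rootMultiplicity (-(α * β)) + n = P.rootMultiplicity α + Q.rootMultiplicity β
  /-- The position of the A-roots. -/
  position : ∀ α β : ℝ, α ≠ 0 → IsARootFst n P Q α → IsARootSnd n P Q β →
    rootsLeft R (-(α * β)) = rootsLeft P α + rootsSide Q (SignType.sign α) β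
  /-- The B-roots are simple. -/
  simple : ∀ x : ℝ, IsBRoot n P Q R x → R.rootMultiplicity x = 1

end

end SchurSzego

namespace SchurSzego

noncomputable section

/-! The composition is an apolar pairing: the roots of `twist Q z` are `-z / q` for the roots `q` of
`Q`, and pairing it with `P` gives `n! * (P ∗ Q)(z)`. Multiplication by `X - w` is adjoint, up to
sign, to the polar derivative at `w`. With Laguerre's theorem this yields a form of Grace's theorem
that includes the boundary case (`apolar_common_root`). For `z` in the upper half-plane the twisted
roots lie strictly above the real axis, so `P ∗ Q` has no zero there and is hyperbolic (`hyp_comp`).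

Write `P = (X - γ) P₁`, `F = P ∗ Q`, `G = P₁ ∗ Q`, all compositions in degree `n`. Then `F - c G` is
the composition in which `γ` is replaced by `γ + c`. It has no zero in the upper half-plane when `Im
c ≤ 0`, so `F / G` takes values with positive imaginary part there (`hermiteBiehler_comp`). Hence a
real zero of `F` that is not a zero of `G` is simple, while a common nonzero zero produces an A-pair
through the boundary case. This makes the B-roots simple.

The same property makes the roots of `F - t G` move to the right as `t ≥ 0` grows from `0`, at most
one of them passing a given point (`rootsLeft_pencil`). Moving every root of `P` to `α` turns `P ∗
Q` into `Q` dilated by `-α`, up to a constant factor, which bounds the number of roots to the left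
of `-αβ` (`rootsLeft_comp_le`). Reflection bounds the number to the right. For an A-pair the
multiplicity is found by differentiation (`rootMultiplicity_comp`). It and the two bounds add up to
`n`, so both bounds are equalities; `α = 0` gives the root signs.

For uniqueness, number the roots from left to right with multiplicity. The rules prescribe the
intervals of ranks that the A-roots occupy, and simple B-roots fill all other ranks
(`blocks_of_rules`). -/

/-! ### The apolar form and polar derivatives -/

/-- The apolar form on polynomials of degree at most `n`. -/
def apolar (n : ℕ) (p s : ℂ[X]) : ℂ :=
  ∑ k ∈ Finset.range (n + 1),
    (-1) ^ k * (k.factorial * (n - k).factorial : ℂ) * (p.coeff k * s.coeff (n - k))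

/-- The polar derivative, with respect to the point `w`, of a polynomial of degree `n`. -/
def polar (n : ℕ) (w : ℂ) (s : ℂ[X]) : ℂ[X] :=
  C (n : ℂ) * s + (C w - X) * derivative s

lemma polar_eval (n : ℕ) (w : ℂ) (s : ℂ[X]) (z : ℂ) :
    (polar n w s).eval z = n * s.eval z + (w - z) * (derivative s).eval z := by
  simp [polar]

lemma polar_coeff (n : ℕ) (w : ℂ) (s : ℂ[X]) (j : ℕ) :
    (polar n w s).coeff j = (n - j) * s.coeff j + w * ((j + 1) * s.coeff (j + 1)) := by
  rw [polar, coeff_add, coeff_C_mul, sub_mul, coeff_sub, coeff_C_mul, coeff_derivative]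
  cases j with
  | zero => simp
  | succ j => rw [coeff_X_mul, coeff_derivative]; push_cast; ring

/-- Adjointness: a known root of `p` is traded for a polar derivative of `s` and one degree. Both
inductions on the form rest on this. -/
lemma apolar_X_sub_C_mul (n : ℕ) (w : ℂ) (p s : ℂ[X]) (hp : p.natDegree ≤ n) :
    apolar (n + 1) ((X - C w) * p) s = -apolar n p (polar (n + 1) w s) := by
  have h1 : ∀ k, ((X - C w) * p).coeff (k + 1) = p.coeff k - w * p.coeff (k + 1) := by
    intro k; rw [sub_mul, coeff_sub, coeff_X_mul, coeff_C_mul]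
  have hX : apolar (n + 1) ((X - C w) * p) s
      = apolar (n + 1) (X * p) s - w * apolar (n + 1) p s := by
    unfold apolar
    rw [Finset.mul_sum, ← Finset.sum_sub_distrib]
    refine Finset.sum_congr rfl fun k _ => ?_
    rw [sub_mul, coeff_sub, coeff_C_mul]; ring
  have hA : apolar (n + 1) (X * p) s = -∑ k ∈ Finset.range (n + 1),
      (-1) ^ k * ((k + 1).factorial * (n - k).factorial : ℂ) * (p.coeff k * s.coeff (n - k)) := by
    unfold apolar
    rw [Finset.sum_range_succ', ← Finset.sum_neg_distrib]
    simp only [coeff_X_mul, coeff_X_mul_zero, zero_mul, mul_zero, add_zero]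
    refine Finset.sum_congr rfl fun k _ => ?_
    rw [Nat.add_sub_add_right]; ring
  have hB : apolar (n + 1) p s = ∑ k ∈ Finset.range (n + 1),
      (-1) ^ k * (k.factorial * (n + 1 - k).factorial : ℂ) *
        (p.coeff k * s.coeff (n + 1 - k)) := by
    unfold apolar
    rw [Finset.sum_range_succ, coeff_eq_zero_of_natDegree_lt (by omega)]
    simp
  rw [hX, hA, hB]
  unfold apolar
  rw [Finset.mul_sum, ← Finset.sum_neg_distrib, ← Finset.sum_neg_distrib, ← Finset.sum_sub_distrib]
  refine Finset.sum_congr rfl fun k hk => ?_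
  have hk' : k ≤ n := Nat.lt_succ_iff.mp (Finset.mem_range.mp hk)
  obtain ⟨j, rfl⟩ := Nat.exists_eq_add_of_le hk'
  rw [polar_coeff]
  have e1 : k + j - k = j := by omega
  have e2 : k + j + 1 - k = j + 1 := by omega
  rw [e1, e2, Nat.factorial_succ, Nat.factorial_succ]
  push_cast
  ring

lemma apolar_comm (n : ℕ) (p s : ℂ[X]) : apolar n s p = (-1) ^ n * apolar n p s := by
  unfold apolar
  rw [← Finset.sum_range_reflect, Finset.mul_sum]
  refine Finset.sum_congr rfl fun k hk => ?_
  have hk' : k ≤ n := Nat.lt_succ_iff.mp (Finset.mem_range.mp hk)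
  obtain ⟨j, rfl⟩ := Nat.exists_eq_add_of_le hk'
  have e1 : k + j + 1 - 1 - k = j := by omega
  have e2 : k + j - j = k := by omega
  have e3 : k + j - k = j := by omega
  rw [e1, e2, e3, pow_add]
  have : ((-1 : ℂ) ^ k) * (-1) ^ k = 1 := by rw [← mul_pow]; simp
  linear_combination (-(-1 : ℂ) ^ j * (k.factorial * j.factorial) * (p.coeff k * s.coeff j)) * this

lemma apolar_sub_left (n : ℕ) (p q s : ℂ[X]) :
    apolar n (p - q) s = apolar n p s - apolar n q s := by
  unfold apolar
  rw [← Finset.sum_sub_distrib]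
  exact Finset.sum_congr rfl fun k _ => by rw [coeff_sub]; ring

lemma apolar_C_mul_left (n : ℕ) (c : ℂ) (p s : ℂ[X]) :
    apolar n (C c * p) s = c * apolar n p s := by
  unfold apolar
  rw [Finset.mul_sum]
  exact Finset.sum_congr rfl fun k _ => by rw [coeff_C_mul]; ring

lemma apolar_C_mul_right (n : ℕ) (c : ℂ) (p s : ℂ[X]) :
    apolar n p (C c * s) = c * apolar n p s := by
  unfold apolar
  rw [Finset.mul_sum]
  exact Finset.sum_congr rfl fun k _ => by rw [coeff_C_mul]; ring

/-- The binomial coefficients of the power absorb the factorial weights, so that the form becomes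
evaluation at `a`. -/
lemma apolar_X_sub_C_pow (n : ℕ) (a : ℂ) (p : ℂ[X]) (hp : p.natDegree ≤ n) :
    apolar n p ((X - C a) ^ n) = n.factorial * p.eval a := by
  unfold apolar
  rw [eval_eq_sum_range' (Nat.lt_succ_of_le hp), Finset.mul_sum]
  refine Finset.sum_congr rfl fun k hk => ?_
  have hk' : k ≤ n := Nat.lt_succ_iff.mp (Finset.mem_range.mp hk)
  have h1 : ((X - C a) ^ n).coeff (n - k) = (-a) ^ k * (n.choose k : ℂ) := by
    rw [sub_eq_add_neg, ← C_neg, coeff_X_add_C_pow, Nat.sub_sub_self hk', Nat.choose_symm hk']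
  rw [h1, ← Nat.choose_mul_factorial_mul_factorial hk', neg_pow]
  have : ((-1 : ℂ) ^ k) * (-1) ^ k = 1 := by rw [← mul_pow]; simp
  push_cast
  linear_combination ((n.choose k : ℂ) * k.factorial * (n - k).factorial * p.coeff k * a ^ k) * this

/-- Differentiating the power cancels `q` of the `p + q` copies of the polynomial. -/
lemma polar_X_sub_C_pow_mul (p q : ℕ) (a : ℂ) (t : ℂ[X]) :
    polar (p + q) a ((X - C a) ^ q * t) = (X - C a) ^ q * polar p a t := by
  have h : (X - C a) * derivative ((X - C a) ^ q) = C (q : ℂ) * (X - C a) ^ q := by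
    rw [derivative_pow]
    cases q with
    | zero => simp
    | succ q => simp [pow_succ]; ring
  unfold polar
  rw [derivative_mul]
  push_cast
  rw [C_add]
  linear_combination (-t) * h

lemma natDegree_polar_le (n : ℕ) (w : ℂ) (s : ℂ[X]) (hs : s.natDegree ≤ n + 1) :
    (polar (n + 1) w s).natDegree ≤ n := by
  rw [natDegree_le_iff_coeff_eq_zero]
  intro j hj
  rw [polar_coeff, coeff_eq_zero_of_natDegree_lt (n := j + 1) (by omega)]
  rcases Nat.lt_or_ge (n + 1) j with h | h
  · rw [coeff_eq_zero_of_natDegree_lt (by omega)]; simp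
  · have : j = n + 1 := by omega
    subst this
    push_cast; ring

/-- When the orders of vanishing at `a` add up to the degree, only one term of the apolar form
survives. -/
lemma apolar_X_sub_C_pow_mul (p q : ℕ) (a : ℂ) (f t : ℂ[X]) (hf : f.natDegree ≤ q)
    (ht : t.natDegree ≤ p) :
    apolar (p + q) ((X - C a) ^ p * f) ((X - C a) ^ q * t)
      = (-1) ^ p * (p.factorial * q.factorial) * (f.eval a * t.eval a) := by
  induction p generalizing t with
  | zero =>
    rw [eq_C_of_natDegree_eq_zero (Nat.le_zero.mp ht)]
    rw [mul_comm _ (C _), apolar_C_mul_right]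
    simp only [pow_zero, one_mul, zero_add, apolar_X_sub_C_pow q a f hf, eval_C]
    simp; ring
  | succ p ih =>
    have e : p + 1 + q = p + q + 1 := by ring
    have hd : ((X - C a) ^ p * f).natDegree ≤ p + q := by
      refine natDegree_mul_le.trans (Nat.add_le_add ?_ hf)
      exact natDegree_pow_le.trans (by rw [natDegree_X_sub_C]; omega)
    rw [e, pow_succ', mul_assoc, apolar_X_sub_C_mul _ _ _ _ hd, ← e, polar_X_sub_C_pow_mul,
      ih _ (natDegree_polar_le _ _ _ ht), polar_eval, Nat.factorial_succ]
    push_cast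
    ring

/-! ### Laguerre's theorem and Grace's theorem for half-planes -/

lemma re_mul_sum_pos {ι : Type*} (μ : ℂ) (f : ι → ℂ) (M : Multiset ι) (hM : M ≠ 0)
    (hf : ∀ u ∈ M, 0 < (μ * f u).re) : 0 < (μ * (M.map f).sum).re := by
  induction M using Multiset.induction with
  | empty => exact absurd rfl hM
  | cons a M ih =>
    rw [Multiset.map_cons, Multiset.sum_cons, mul_add, Complex.add_re]
    have h1 := hf a (Multiset.mem_cons_self _ _)
    rcases eq_or_ne M 0 with rfl | h
    · simpa using h1
    · exact add_pos h1 (ih h fun u hu => hf u (Multiset.mem_cons_of_mem hu))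

/-- Laguerre's theorem on polar derivatives, for closed half-planes. -/
lemma isRoot_of_isRoot_polar (σ : ℝ) (n : ℕ) (w z : ℂ) (s : ℂ[X]) (hn : 0 < n)
    (hs : s.natDegree = n) (hroots : ∀ u, s.IsRoot u → 0 ≤ σ * u.im) (hw : σ * w.im < 0)
    (hz : (polar n w s).IsRoot z) (hzim : σ * z.im ≤ 0) : s.IsRoot z := by
  by_contra hsz
  have hsz' : s.eval z ≠ 0 := hsz
  have hs0 : s ≠ 0 := by rintro rfl; simp at hsz'
  have hsplit := IsAlgClosed.splits s
  have hpol : (n : ℂ) * s.eval z + (w - z) * (derivative s).eval z = 0 := by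
    rw [← polar_eval]; exact hz
  have hn0 : (n : ℂ) ≠ 0 := by exact_mod_cast hn.ne'
  have hzw : z - w ≠ 0 := by
    intro h
    have : w - z = 0 := by linear_combination -h
    rw [this, zero_mul, add_zero] at hpol
    exact (mul_ne_zero hn0 hsz') hpol
  have hlog := hsplit.eval_derivative_div_eval_of_ne_zero hsz'
  have hsum : (s.roots.map fun u => 1 / (z - u)).sum = n * (1 / (z - w)) := by
    rw [← hlog]; field_simp; linear_combination -hpol
  set κ : ℂ := 1 / (z - w) with hκ
  have hcard : s.roots.card = n := by rw [← hs]; exact (hsplit.natDegree_eq_card_roots).symm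
  have hzero : (s.roots.map fun u => 1 / (z - u) - κ).sum = 0 := by
    rw [Multiset.sum_map_sub, hsum, Multiset.map_const', Multiset.sum_replicate, hcard]
    simp
  -- With `φ ζ = σ * ζ.im + σ * z.im * |ζ|²`, the point `ζ = 1 / (z - v)` has `φ ζ = σ * v.im *
  -- |ζ|²`. So `φ ≥ 0` at the images of the roots and `φ κ < 0`. Since `φ` is concave, its gradient
  -- at `κ`, which is `μ`, has positive pairing with every `ζ - κ`; but these differences sum to
  -- zero.
  set μ : ℂ := -(σ : ℂ) * Complex.I + 2 * ((σ * z.im : ℝ) : ℂ) * (starRingEnd ℂ) κ with hμ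
  have hM : s.roots ≠ 0 := by
    intro h; rw [h] at hcard; simp at hcard; omega
  have key := re_mul_sum_pos μ (fun u => 1 / (z - u) - κ) s.roots hM ?_
  · rw [hzero] at key; simp at key
  intro u hu
  have hu' : 0 ≤ σ * u.im := hroots u (isRoot_of_mem_roots hu)
  have hzu : z - u ≠ 0 := by
    intro h
    have : z = u := by linear_combination h
    rw [this] at hsz
    exact hsz (isRoot_of_mem_roots hu)
  have him : ∀ v : ℂ, (1 / (z - v)).im = (v.im - z.im) * Complex.normSq (1 / (z - v)) := by
    intro v
    rw [one_div, Complex.inv_im, Complex.normSq_inv, Complex.sub_im]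
    ring
  have h1 := him u
  have h2 := him w
  rw [← hκ] at h2
  set ζ : ℂ := 1 / (z - u) with hζ
  have hκpos : 0 < Complex.normSq κ := Complex.normSq_pos.mpr (one_div_ne_zero hzw)
  have hζ0 : 0 ≤ Complex.normSq ζ := Complex.normSq_nonneg ζ
  have expand : (μ * (ζ - κ)).re = σ * u.im * Complex.normSq ζ - σ * w.im * Complex.normSq κ
      - σ * z.im * Complex.normSq (ζ - κ) := by
    have e1 : (μ * (ζ - κ)).re = σ * ζ.im - σ * κ.im
        + 2 * (σ * z.im) * (κ.re * (ζ.re - κ.re) + κ.im * (ζ.im - κ.im)) := by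
      simp [hμ, Complex.mul_re, Complex.mul_im]; ring
    rw [e1]
    simp only [Complex.normSq_apply, Complex.sub_re, Complex.sub_im] at h1 h2 ⊢
    linear_combination σ * h1 - σ * h2
  rw [expand]
  have a1 : 0 ≤ σ * u.im * Complex.normSq ζ := mul_nonneg hu' hζ0
  have a2 : 0 < -(σ * w.im) * Complex.normSq κ := mul_pos (by linarith) hκpos
  have a3 : 0 ≤ -(σ * z.im) * Complex.normSq (ζ - κ) :=
    mul_nonneg (by linarith) (Complex.normSq_nonneg _)
  linarith

/-- The coefficient of `X ^ n` is a nonzero multiple of the sum of `u - w` over the roots `u`, and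
all these differences lie in one open half-plane. -/
lemma natDegree_polar (σ : ℝ) (n : ℕ) (w : ℂ) (s : ℂ[X]) (hs : s.natDegree = n + 1)
    (hroots : ∀ u, s.IsRoot u → 0 ≤ σ * u.im) (hw : σ * w.im < 0) :
    (polar (n + 1) w s).natDegree = n ∧ polar (n + 1) w s ≠ 0 := by
  have hsplit := IsAlgClosed.splits s
  have hcard : s.roots.card = n + 1 := by rw [← hs]; exact (hsplit.natDegree_eq_card_roots).symm
  have hs0 : s ≠ 0 := by rintro rfl; simp at hs
  have hnext : s.coeff n = -s.leadingCoeff * s.roots.sum := by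
    rw [← hsplit.nextCoeff_eq_neg_sum_roots_mul_leadingCoeff,
      nextCoeff_of_natDegree_pos (by omega), hs]; rfl
  have hlead : s.coeff (n + 1) = s.leadingCoeff := by rw [leadingCoeff, hs]
  have hcoeff : (polar (n + 1) w s).coeff n
      = -s.leadingCoeff * (s.roots.map fun u => u - w).sum := by
    rw [polar_coeff, hnext, hlead, Multiset.sum_map_sub, Multiset.map_id', Multiset.map_const',
      Multiset.sum_replicate, hcard, nsmul_eq_mul]
    push_cast; ring
  have hne : (polar (n + 1) w s).coeff n ≠ 0 := by
    rw [hcoeff]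
    refine mul_ne_zero (neg_ne_zero.mpr (leadingCoeff_ne_zero.mpr hs0)) fun h => ?_
    have := re_mul_sum_pos (-(σ : ℂ) * Complex.I) (fun u => u - w) s.roots
      (by intro h; rw [h] at hcard; simp at hcard) (fun u hu => by
        have := hroots u (isRoot_of_mem_roots hu)
        simp [Complex.mul_re]
        linarith)
    rw [h] at this
    simp at this
  exact ⟨natDegree_eq_of_le_of_coeff_ne_zero (natDegree_polar_le n w s hs.le) hne,
    fun h => hne (by rw [h, coeff_zero])⟩

lemma rootMultiplicity_polar (n : ℕ) (w a : ℂ) (s : ℂ[X]) (hs0 : s ≠ 0) (ha : s.IsRoot a)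
    (hwa : w ≠ a) : (polar n w s).rootMultiplicity a + 1 = s.rootMultiplicity a := by
  obtain ⟨t, ht, hnd⟩ := exists_eq_pow_rootMultiplicity_mul_and_not_dvd s hs0 a
  have hpos : 0 < s.rootMultiplicity a := (rootMultiplicity_pos hs0).mpr ha
  obtain ⟨m, hm⟩ : ∃ m, s.rootMultiplicity a = m + 1 := ⟨_, (Nat.succ_pred_eq_of_pos hpos).symm⟩
  rw [hm] at ht ⊢
  have hta : t.eval a ≠ 0 := fun h => hnd (dvd_iff_isRoot.mpr h)
  set U : ℂ[X] := C (n : ℂ) * ((X - C a) * t)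
    + (C w - X) * (C ((m : ℂ) + 1) * t + (X - C a) * derivative t) with hU
  have hUa : U.eval a ≠ 0 := by
    simp only [hU, eval_add, eval_mul, eval_C, eval_sub, eval_X, sub_self, zero_mul, mul_zero,
      zero_add, add_zero]
    exact mul_ne_zero (sub_ne_zero.mpr hwa) (mul_ne_zero (Nat.cast_add_one_ne_zero m) hta)
  have hfac : polar n w s = (X - C a) ^ m * U := by
    rw [polar, ht, derivative_mul, derivative_X_sub_C_pow, hU]
    simp [pow_succ]
    ring
  have hU0 : U ≠ 0 := by rintro h; rw [h] at hUa; simp at hUa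
  rw [hfac, rootMultiplicity_mul (mul_ne_zero (pow_ne_zero _ (X_sub_C_ne_zero a)) hU0),
    rootMultiplicity_X_sub_C_pow, rootMultiplicity_eq_zero hUa]

/-- Two apolar polynomials of degree `n` with roots in opposite closed half-planes and not all
roots real share a real root, and the multiplicities of this root add up to more than `n`. -/
theorem apolar_common_root (n : ℕ) : ∀ (σ : ℝ) (p s : ℂ[X]), p ≠ 0 → s ≠ 0 →
    p.natDegree = n → s.natDegree = n →
    (∀ z, p.IsRoot z → σ * z.im ≤ 0) → (∀ z, s.IsRoot z → 0 ≤ σ * z.im) → σ ≠ 0 →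
    apolar n p s = 0 → ((∃ z, p.IsRoot z ∧ z.im ≠ 0) ∨ ∃ z, s.IsRoot z ∧ z.im ≠ 0) →
    ∃ a : ℝ, n < p.rootMultiplicity (a : ℂ) + s.rootMultiplicity (a : ℂ) := by
  induction n with
  | zero =>
    intro σ p s hp0 hs0 hp hs _ _ _ hap
    rw [eq_C_of_natDegree_eq_zero hp] at hp0
    rw [eq_C_of_natDegree_eq_zero hs] at hs0
    simp [apolar] at hap
    rcases hap with h | h
    · rw [h] at hp0; simp at hp0
    · rw [h] at hs0; simp at hs0
  | succ n ih =>
    -- The form is symmetric up to sign, so the nonreal root may be taken to belong to `p`; the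
    -- other case follows by swapping and negating `σ`.
    have main : ∀ (σ : ℝ) (p s : ℂ[X]), p ≠ 0 → s ≠ 0 →
        p.natDegree = n + 1 → s.natDegree = n + 1 →
        (∀ z, p.IsRoot z → σ * z.im ≤ 0) → (∀ z, s.IsRoot z → 0 ≤ σ * z.im) → σ ≠ 0 →
        apolar (n + 1) p s = 0 → (∃ z, p.IsRoot z ∧ z.im ≠ 0) →
        ∃ a : ℝ, n + 1 < p.rootMultiplicity (a : ℂ) + s.rootMultiplicity (a : ℂ) := by
      rintro σ p s hp0 hs0 hp hs hpr hsr hσ hap ⟨w, hw, hwim⟩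
      have hσw : σ * w.im < 0 := lt_of_le_of_ne (hpr w hw) (mul_ne_zero hσ hwim)
      obtain ⟨p₁, rfl⟩ := dvd_iff_isRoot.mpr hw
      have hp10 : p₁ ≠ 0 := right_ne_zero_of_mul hp0
      have hp1 : p₁.natDegree = n := by
        rw [natDegree_mul (X_sub_C_ne_zero w) hp10, natDegree_X_sub_C] at hp; omega
      rw [apolar_X_sub_C_mul _ _ _ _ hp1.le, neg_eq_zero] at hap
      obtain ⟨hTdeg, hT0⟩ := natDegree_polar σ n w s hs hsr hσw
      set T := polar (n + 1) w s with hT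
      have hwreal : ∀ a : ℂ, a.im = 0 → w ≠ a := by
        rintro a ha rfl; exact hwim ha
      have hTr : ∀ z, T.IsRoot z → 0 ≤ σ * z.im := by
        intro z hz
        by_contra hneg
        push Not at hneg
        exact hneg.not_ge
          (hsr z (isRoot_of_isRoot_polar σ (n + 1) w z s n.succ_pos hs hsr hσw hz hneg.le))
      have hTs : ∀ z, T.IsRoot z → z.im = 0 → T.rootMultiplicity z + 1 = s.rootMultiplicity z := by
        intro z hz hzim
        have := isRoot_of_isRoot_polar σ (n + 1) w z s n.succ_pos hs hsr hσw hz (by simp [hzim])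
        exact rootMultiplicity_polar (n + 1) w z s hs0 this (hwreal z hzim)
      have hle : ∀ a : ℂ, p₁.rootMultiplicity a ≤ ((X - C w) * p₁).rootMultiplicity a := by
        intro a; rw [rootMultiplicity_mul hp0]; omega
      by_cases hnr : ∃ z, T.IsRoot z ∧ z.im ≠ 0
      · obtain ⟨a, ha⟩ := ih σ p₁ T hp10 hT0 hp1 hTdeg
          (fun z hz => hpr z (by
            rw [IsRoot.def, eval_mul, IsRoot.def.mp hz, mul_zero])) hTr hσ hap (Or.inr hnr)
        refine ⟨a, ?_⟩
        have h1 := hle a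
        rcases Nat.eq_zero_or_pos (T.rootMultiplicity (a : ℂ)) with h0 | hpos
        · have : p₁.rootMultiplicity (a : ℂ) ≤ p₁.natDegree := by
            rw [← count_roots]; exact (Multiset.count_le_card _ _).trans (card_roots' p₁)
          omega
        · have := hTs a ((rootMultiplicity_pos hT0).mp hpos) (by simp)
          omega
      · push Not at hnr
        have hTcard : T.roots.card = n := by
          rw [← hTdeg]; exact (IsAlgClosed.splits T).natDegree_eq_card_roots.symm
        rcases Nat.eq_zero_or_pos n with rfl | hnpos
        · exfalso
          simp only [apolar] at hap
          rw [eq_C_of_natDegree_eq_zero hp1] at hp10 hap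
          rw [eq_C_of_natDegree_eq_zero hTdeg] at hT0 hap
          simp at hap hp10 hT0
          tauto
        · have hTne : T.roots ≠ 0 := by
            intro h; rw [h] at hTcard; simp at hTcard; omega
          obtain ⟨b, hb⟩ := Multiset.exists_mem_of_ne_zero hTne
          -- Every root of `T`, being real, has one unit more of multiplicity in `s`, but the
          -- degrees differ by one only: `T` has a single distinct root `b`. Then `s` is a multiple
          -- of `(X - C b) ^ (n + 1)`, and apolarity says that `b` is a root of `p`.
          have hTroots : ∀ c ∈ T.roots, c = b := by
            intro c hc
            by_contra hcb
            have hsub : c ::ₘ b ::ₘ T.roots ≤ s.roots := by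
              rw [Multiset.le_iff_count]
              intro d
              have hcount : d ∈ T.roots → T.roots.count d + 1 = s.roots.count d := by
                intro hd
                rw [count_roots, count_roots]
                have := isRoot_of_mem_roots hd
                exact hTs d this (hnr d this)
              rcases eq_or_ne d c with rfl | hdc
              · rw [Multiset.count_cons_self, Multiset.count_cons_of_ne hcb, hcount hc]
              · rw [Multiset.count_cons_of_ne hdc]
                rcases eq_or_ne d b with rfl | hdb
                · rw [Multiset.count_cons_self, hcount hb]
                · rw [Multiset.count_cons_of_ne hdb]
                  by_cases hd : d ∈ T.roots
                  · have := hcount hd; omega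
                  · rw [Multiset.count_eq_zero_of_notMem hd]; omega
            have h1 := Multiset.card_le_card hsub
            have h2 := card_roots' s
            simp only [Multiset.card_cons] at h1
            omega
          have hrep := Multiset.eq_replicate.mpr ⟨hTcard, hTroots⟩
          have hbroot := isRoot_of_mem_roots hb
          have hbim := hnr b hbroot
          have hTb : T.rootMultiplicity b = n := by
            rw [← count_roots, hrep, Multiset.count_replicate_self]
          have hsb : s.rootMultiplicity b = n + 1 := by rw [← hTs b hbroot hbim, hTb]
          have hsroots : s.roots = Multiset.replicate (n + 1) b := by
            symm
            refine Multiset.eq_of_le_of_card_le ?_ ?_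
            · rw [← Multiset.le_count_iff_replicate_le, count_roots, hsb]
            · rw [Multiset.card_replicate, ← hs]; exact card_roots' s
          have hseq : s = C s.leadingCoeff * (X - C b) ^ (n + 1) := by
            conv_lhs => rw [(IsAlgClosed.splits s).eq_prod_roots, hsroots, Multiset.map_replicate, Multiset.prod_replicate]
          have hroot : ((X - C w) * p₁).IsRoot b := by
            have h := apolar_X_sub_C_pow (n + 1) b ((X - C w) * p₁) hp.le
            have h' : apolar (n + 1) ((X - C w) * p₁) s = 0 := by
              rw [apolar_X_sub_C_mul _ _ _ _ hp1.le, ← hT, hap, neg_zero]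
            rw [hseq, apolar_C_mul_right, h] at h'
            have hl := leadingCoeff_ne_zero.mpr hs0
            have hf : ((n + 1).factorial : ℂ) ≠ 0 := by exact_mod_cast Nat.factorial_ne_zero _
            simpa [hl, hf] using h'
          refine ⟨b.re, ?_⟩
          have hbre : ((b.re : ℝ) : ℂ) = b := by
            apply Complex.ext <;> simp [hbim]
          rw [hbre, hsb]
          have := (rootMultiplicity_pos hp0).mpr hroot
          omega
    intro σ p s hp0 hs0 hp hs hpr hsr hσ hap hnr
    rcases hnr with h | h
    · exact main σ p s hp0 hs0 hp hs hpr hsr hσ hap h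
    · obtain ⟨a, ha⟩ := main (-σ) s p hs0 hp0 hs hp (fun z hz => by have := hsr z hz; linarith)
        (fun z hz => by have := hpr z hz; linarith) (neg_ne_zero.mpr hσ)
        (by rw [apolar_comm, hap, mul_zero]) h
      exact ⟨a, by omega⟩

/-! ### Algebra of the composition -/

lemma comp_coeff (n : ℕ) (P Q : ℝ[X]) (i : ℕ) :
    (comp n P Q).coeff i = P.coeff i * Q.coeff i / (n.choose i : ℝ) := by
  simp only [comp, finsetSum_coeff, coeff_monomial, diagSeq]
  rw [Finset.sum_ite_eq']
  split_ifs with h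
  · have : (n.choose i : ℝ) ≠ 0 := by
      exact_mod_cast (Nat.choose_pos (Nat.lt_succ_iff.mp (Finset.mem_range.mp h))).ne'
    field_simp
  · rw [Nat.choose_eq_zero_of_lt (by simpa using h)]; simp

lemma comp_sub_left (n : ℕ) (P P' Q : ℝ[X]) :
    comp n (P - P') Q = comp n P Q - comp n P' Q := by
  ext i; simp only [comp_coeff, coeff_sub]; ring

lemma comp_C_mul_left (n : ℕ) (c : ℝ) (P Q : ℝ[X]) :
    comp n (C c * P) Q = C c * comp n P Q := by
  ext i; simp only [comp_coeff, coeff_C_mul]; ring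

lemma coeff_comp_neg_X (P : ℝ[X]) (i : ℕ) :
    (P.comp (-X)).coeff i = P.coeff i * (-1) ^ i := by
  rw [show (-X : ℝ[X]) = C (-1) * X by simp, comp_C_mul_X_coeff]

lemma comp_comp_neg_X (n : ℕ) (P Q : ℝ[X]) :
    comp n (P.comp (-X)) Q = (comp n P Q).comp (-X) := by
  ext i
  simp only [comp_coeff, coeff_comp_neg_X]
  ring

/-- Differentiation commutes with composition up to a factor, by `(n + 1) * n.choose i = (i + 1) *
(n + 1).choose (i + 1)`. -/
lemma derivative_comp (n : ℕ) (P Q : ℝ[X]) :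
    C ((n : ℝ) + 1) * derivative (comp (n + 1) P Q)
      = comp n (derivative P) (derivative Q) := by
  ext i
  simp only [coeff_C_mul, coeff_derivative, comp_coeff]
  rcases Nat.lt_or_ge n i with h | h
  · rw [Nat.choose_eq_zero_of_lt h, Nat.choose_eq_zero_of_lt (by omega)]; simp
  · have h1 : (n.choose i : ℝ) ≠ 0 := by exact_mod_cast (Nat.choose_pos h).ne'
    have h2 : ((n + 1).choose (i + 1) : ℝ) ≠ 0 := by
      exact_mod_cast (Nat.choose_pos (by omega)).ne'
    have h3 : ((n : ℝ) + 1) * n.choose i = (n + 1).choose (i + 1) * ((i : ℝ) + 1) := by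
      exact_mod_cast Nat.add_one_mul_choose_eq n i
    field_simp
    linear_combination (P.coeff (i + 1) * Q.coeff (i + 1)) * h3

lemma Hyp.natDegree {n : ℕ} {P : ℝ[X]} (h : Hyp n P) : P.natDegree = n :=
  natDegree_eq_of_degree_eq_some h.1

lemma Hyp.ne_zero {n : ℕ} {P : ℝ[X]} (h : Hyp n P) : P ≠ 0 := by
  rintro rfl; simpa using h.1

lemma hyp_of_natDegree {n : ℕ} {P : ℝ[X]} (h0 : P ≠ 0) (hd : P.natDegree = n) (hs : P.Splits) :
    Hyp n P := ⟨by rw [degree_eq_natDegree h0, hd], hs⟩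

lemma Hyp.card_roots {n : ℕ} {P : ℝ[X]} (h : Hyp n P) : P.roots.card = n := by
  rw [← h.2.natDegree_eq_card_roots, h.natDegree]

lemma coeff_prod_X_sub_C_pos (s : Multiset ℝ) (hs : ∀ q ∈ s, q < 0) :
    ∀ i ≤ s.card, 0 < ((s.map fun q => X - C q).prod).coeff i := by
  induction s using Multiset.induction with
  | empty => intro i hi; simp at hi; simp [hi]
  | cons a s ih =>
    intro i hi
    have ha : 0 < -a := by linarith [hs a (Multiset.mem_cons_self _ _)]
    have ih' := ih fun q hq => hs q (Multiset.mem_cons_of_mem hq)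
    have hnn : ∀ j, 0 ≤ ((s.map fun q => X - C q).prod).coeff j := by
      intro j
      rcases Nat.lt_or_ge s.card j with h | h
      · rw [coeff_eq_zero_of_natDegree_lt]
        rwa [natDegree_multiset_prod_X_sub_C_eq_card]
      · exact (ih' j h).le
    rw [Multiset.map_cons, Multiset.prod_cons, sub_mul, coeff_sub, coeff_C_mul]
    rw [Multiset.card_cons] at hi
    cases i with
    | zero =>
      rw [coeff_X_mul_zero]
      have := mul_pos ha (ih' 0 (Nat.zero_le _))
      linarith
    | succ i =>
      rw [coeff_X_mul]
      have h1 := ih' i (by omega)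
      have h2 := mul_nonneg ha.le (hnn (i + 1))
      linarith

/-- Negative roots make all coefficients of one sign, so composing with `Q` loses no coefficient of
`P`. -/
lemma HypNeg.coeff_ne_zero {n : ℕ} {Q : ℝ[X]} (h : HypNeg n Q) {i : ℕ} (hi : i ≤ n) :
    Q.coeff i ≠ 0 := by
  rw [h.1.2.eq_prod_roots, coeff_C_mul]
  refine mul_ne_zero (leadingCoeff_ne_zero.mpr h.1.ne_zero) (ne_of_gt ?_)
  refine coeff_prod_X_sub_C_pos _ (fun q hq => h.2 q (isRoot_of_mem_roots hq)) i ?_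
  rwa [h.1.card_roots]

lemma comp_natDegree {n : ℕ} {P Q : ℝ[X]} (hP : P.natDegree = n) (hP0 : P ≠ 0)
    (hQ : HypNeg n Q) : (comp n P Q).natDegree = n ∧ comp n P Q ≠ 0 := by
  have hne : (comp n P Q).coeff n ≠ 0 := by
    rw [comp_coeff, Nat.choose_self]
    have : P.coeff n ≠ 0 := by rw [← hP]; exact leadingCoeff_ne_zero.mpr hP0
    simpa using ⟨this, hQ.coeff_ne_zero le_rfl⟩
  refine ⟨natDegree_eq_of_le_of_coeff_ne_zero ?_ hne, fun h => hne (by rw [h, coeff_zero])⟩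
  rw [natDegree_le_iff_coeff_eq_zero]
  intro j hj
  rw [comp_coeff, Nat.choose_eq_zero_of_lt hj]; simp

/-! ### The composition as an apolar pairing -/

lemma rootMultiplicity_reverse {K : Type*} [Field K] (f : K[X]) (hf : f ≠ 0) (a : K)
    (ha : a ≠ 0) : f.reverse.rootMultiplicity a⁻¹ = f.rootMultiplicity a := by
  obtain ⟨g, hg, hnd⟩ := exists_eq_pow_rootMultiplicity_mul_and_not_dvd f hf a
  set m := f.rootMultiplicity a with hm
  have hga : g.eval a ≠ 0 := fun h => hnd (dvd_iff_isRoot.mpr h)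
  have hg0 : g ≠ 0 := by rintro rfl; simp at hga
  have hrev : (X - C a).reverse = C (-a) * (X - C a⁻¹) := by
    have h1 : (X - C a : K[X]).natDegree = 1 := natDegree_X_sub_C a
    have h2 : (1 : K[X]) = C (a * a⁻¹) := by rw [mul_inv_cancel₀ ha, C_1]
    rw [reverse, h1, reflect_sub, reflect_C]
    have : reflect 1 (X : K[X]) = 1 := by simp
    rw [this, pow_one, C_neg]
    linear_combination h2 + (C_mul (a := a) (b := a⁻¹))
  have hpow : ∀ k : ℕ, ((X - C a) ^ k).reverse = (C (-a) * (X - C a⁻¹)) ^ k := by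
    intro k
    induction k with
    | zero => simp [← C_1, -map_one]
    | succ k ih => rw [pow_succ, reverse_mul_of_domain, ih, hrev, pow_succ]
  have hgr : g.reverse.eval a⁻¹ ≠ 0 := by
    intro h
    let := invertibleOfNonzero ha
    have := (eval₂_reverse_eq_zero_iff (RingHom.id K) a g).mp (by simpa [eval₂_id] using h)
    exact hga (by simpa [eval₂_id] using this)
  have hgr0 : g.reverse ≠ 0 := by intro h; rw [h] at hgr; simp at hgr
  have hc : C ((-a) ^ m) ≠ 0 := by simpa using fun h : a = 0 => absurd h ha
  rw [hg, reverse_mul_of_domain, hpow, mul_pow, ← C_pow, mul_assoc]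
  rw [rootMultiplicity_mul (mul_ne_zero hc (mul_ne_zero (pow_ne_zero _ (X_sub_C_ne_zero _)) hgr0)),
    rootMultiplicity_C, rootMultiplicity_mul (mul_ne_zero (pow_ne_zero _ (X_sub_C_ne_zero _)) hgr0),
    rootMultiplicity_X_sub_C_pow, rootMultiplicity_eq_zero hgr]
  simp

/-- The polynomial `y ^ n * Q (-z / y)` for `Q` of degree `n`; its roots are `-z / q` for the
roots `q` of `Q`. -/
def twist (Q : ℝ[X]) (z : ℂ) : ℂ[X] := (Q.map Complex.ofRealHom).reverse.scaleRoots (-z)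

lemma natDegree_reverse_map {n : ℕ} {Q : ℝ[X]} (hQ : Q.natDegree = n) (hQ0 : Q.coeff 0 ≠ 0) :
    (Q.map Complex.ofRealHom).reverse.natDegree = n := by
  have h0 : (Q.map Complex.ofRealHom).coeff 0 ≠ 0 := by
    rw [coeff_map]; simpa using hQ0
  rw [reverse_natDegree, natTrailingDegree_eq_zero.mpr (Or.inr h0), natDegree_map, hQ, Nat.sub_zero]

lemma twist_natDegree {n : ℕ} {Q : ℝ[X]} (hQ : Q.natDegree = n) (hQ0 : Q.coeff 0 ≠ 0) (z : ℂ) :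
    (twist Q z).natDegree = n := by
  rw [twist, natDegree_scaleRoots, natDegree_reverse_map hQ hQ0]

lemma reverse_map_ne_zero {Q : ℝ[X]} (hQ : Q ≠ 0) :
    (Q.map Complex.ofRealHom).reverse ≠ 0 := by
  simpa [reverse_eq_zero] using hQ

lemma twist_ne_zero {Q : ℝ[X]} (hQ : Q ≠ 0) (z : ℂ) : twist Q z ≠ 0 :=
  scaleRoots_ne_zero (reverse_map_ne_zero hQ) _

/-- The coefficient of `twist Q z` at `n - k` is `Q.coeff k * (-z) ^ k`: the signs cancel, and `k!
(n - k)!` equals `n!` divided by the binomial coefficient. -/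
lemma apolar_map_twist {n : ℕ} {Q : ℝ[X]} (hQ : Q.natDegree = n) (hQ0 : Q.coeff 0 ≠ 0) (P : ℝ[X]) (z : ℂ) :
    apolar n (P.map Complex.ofRealHom) (twist Q z)
      = n.factorial * ((comp n P Q).map Complex.ofRealHom).eval z := by
  have hdeg : ((comp n P Q).map Complex.ofRealHom).natDegree < n + 1 := by
    rw [natDegree_map]
    refine Nat.lt_succ_of_le ?_
    rw [natDegree_le_iff_coeff_eq_zero]
    intro j hj
    rw [comp_coeff, Nat.choose_eq_zero_of_lt hj]; simp
  rw [eval_eq_sum_range' hdeg, Finset.mul_sum, apolar]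
  refine Finset.sum_congr rfl fun k hk => ?_
  have hk' : k ≤ n := Nat.lt_succ_iff.mp (Finset.mem_range.mp hk)
  have h1 : (twist Q z).coeff (n - k) = (Q.coeff k : ℂ) * (-z) ^ k := by
    rw [twist, coeff_scaleRoots, natDegree_reverse_map hQ hQ0, coeff_reverse, natDegree_map,
      hQ, revAt_le (Nat.sub_le n k), Nat.sub_sub_self hk', coeff_map]
    rfl
  rw [h1, coeff_map, coeff_map, comp_coeff, ← Nat.choose_mul_factorial_mul_factorial hk', neg_pow]
  have h2 : ((-1 : ℂ) ^ k) * (-1) ^ k = 1 := by rw [← mul_pow]; simp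
  have h3 : (n.choose k : ℂ) ≠ 0 := by exact_mod_cast (Nat.choose_pos hk').ne'
  simp only [Complex.ofRealHom_eq_coe]
  push_cast
  field_simp
  linear_combination (k.factorial * (n - k).factorial * P.coeff k * Q.coeff k * z ^ k : ℂ) * h2

lemma exists_root_of_twist {n : ℕ} {Q : ℝ[X]} (hQ : HypNeg n Q) {z u : ℂ} (hz : z ≠ 0)
    (hu : (twist Q z).IsRoot u) : ∃ q : ℝ, q < 0 ∧ u = -z / q := by
  have hz' : -z ≠ 0 := neg_ne_zero.mpr hz
  have h1 : (Q.map Complex.ofRealHom).reverse.IsRoot (u / -z) := by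
    have h := rootMultiplicity_scaleRoots (Q.map Complex.ofRealHom).reverse (r := -z) (a := u / -z)
      (IsRegular.of_ne_zero hz').left
    rw [mul_div_cancel₀ _ hz'] at h
    rw [← rootMultiplicity_pos (reverse_map_ne_zero hQ.1.ne_zero), ← h]
    exact (rootMultiplicity_pos (twist_ne_zero hQ.1.ne_zero z)).mpr hu
  have hne : u / -z ≠ 0 := by
    intro h
    rw [h, IsRoot.def, ← coeff_zero_eq_eval_zero, coeff_zero_reverse, leadingCoeff_eq_zero] at h1
    exact hQ.1.ne_zero (by simpa using h1)
  have h2 : (Q.map Complex.ofRealHom).IsRoot (u / -z)⁻¹ := by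
    have h := rootMultiplicity_reverse (Q.map Complex.ofRealHom)
      (by simpa using hQ.1.ne_zero) (u / -z)⁻¹ (inv_ne_zero hne)
    rw [inv_inv] at h
    rw [← rootMultiplicity_pos (by simpa using hQ.1.ne_zero), ← h]
    exact (rootMultiplicity_pos (reverse_map_ne_zero hQ.1.ne_zero)).mpr h1
  obtain ⟨q, hq⟩ := hQ.1.2.mem_range_of_isRoot hQ.1.ne_zero h2
  refine ⟨q, hQ.2 q ?_, ?_⟩
  · rw [← hq, IsRoot.def, eval_map] at h2
    have h2' : ((Q.eval q : ℝ) : ℂ) = 0 := by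
      rw [← h2]
      exact (eval₂_hom Complex.ofRealHom q).symm
    exact_mod_cast h2'
  · have : (q : ℂ) = (u / -z)⁻¹ := hq
    have hu0 : u ≠ 0 := by rintro rfl; simp at hne
    rw [this]; field_simp

lemma rootMultiplicity_twist {Q : ℝ[X]} (hQ : Q ≠ 0) {x a : ℝ} (hx : x ≠ 0)
    (ha : a ≠ 0) : (twist Q x).rootMultiplicity (a : ℂ) = Q.rootMultiplicity (-x / a) := by
  have hx' : -(x : ℂ) ≠ 0 := by exact_mod_cast neg_ne_zero.mpr hx
  have hxa : -x / a ≠ 0 := div_ne_zero (neg_ne_zero.mpr hx) ha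
  have h := rootMultiplicity_scaleRoots (Q.map Complex.ofRealHom).reverse (r := -(x : ℂ))
    (a := (a : ℂ) / -x) (IsRegular.of_ne_zero hx').left
  rw [mul_div_cancel₀ _ hx'] at h
  have e : (a : ℂ) / -x = (((-x / a : ℝ) : ℂ))⁻¹ := by push_cast; rw [inv_div]
  rw [twist, h, e, rootMultiplicity_reverse _ (by simpa using hQ) _
    (by exact_mod_cast hxa)]
  exact (eq_rootMultiplicity_map (f := Complex.ofRealHom) Complex.ofRealHom.injective (-x / a)).symm

lemma eval_map_ofReal (F : ℝ[X]) (z : ℂ) : (F.map Complex.ofRealHom).eval z = aeval z F := by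
  rw [aeval_def, eval_map]; rfl

lemma aeval_ofReal_eq_eval (F : ℝ[X]) (x : ℝ) : aeval (x : ℂ) F = ((F.eval x : ℝ) : ℂ) := by
  rw [aeval_def]
  exact (eval₂_hom Complex.ofRealHom x)

/-! ### Hyperbolicity of the composition -/

/-- A complex polynomial of degree `n` without roots in the open upper half-plane has no zero in
the open upper half-plane after composition with a polynomial with negative roots. -/
lemma apolar_twist_ne_zero {n : ℕ} {Q : ℝ[X]} (hQ : HypNeg n Q) (p : ℂ[X]) (hp0 : p ≠ 0)
    (hp : p.natDegree = n) (hroots : ∀ u, p.IsRoot u → u.im ≤ 0) (z : ℂ) (hz : 0 < z.im) :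
    apolar n p (twist Q z) ≠ 0 := by
  intro hap
  have hQ0 := hQ.coeff_ne_zero (Nat.zero_le n)
  have hz0 : z ≠ 0 := by rintro rfl; simp at hz
  have ht0 := twist_ne_zero hQ.1.ne_zero z
  have htd := twist_natDegree hQ.1.natDegree hQ0 z
  have him : ∀ u, (twist Q z).IsRoot u → 0 < u.im := by
    intro u hu
    obtain ⟨q, hq, rfl⟩ := exists_root_of_twist hQ hz0 hu
    rw [Complex.div_ofReal_im, Complex.neg_im]
    exact div_pos_of_neg_of_neg (by linarith) hq
  rcases Nat.eq_zero_or_pos n with rfl | hn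
  · rw [eq_C_of_natDegree_eq_zero hp] at hp0 hap
    rw [eq_C_of_natDegree_eq_zero htd] at ht0 hap
    simp [apolar] at hap hp0 ht0
    tauto
  · obtain ⟨u, hu⟩ := (IsAlgClosed.splits (twist Q z)).exists_eval_eq_zero
      (by rw [degree_eq_natDegree ht0, htd]; exact_mod_cast hn.ne')
    obtain ⟨a, ha⟩ := apolar_common_root n 1 p (twist Q z) hp0 ht0 hp htd
      (by simpa using hroots) (fun v hv => by simpa using (him v hv).le) one_ne_zero hap
      (Or.inr ⟨u, hu, (him u hu).ne'⟩)
    have h1 : p.rootMultiplicity (a : ℂ) ≤ n := by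
      rw [← count_roots, ← hp]; exact (Multiset.count_le_card _ _).trans (card_roots' p)
    -- Since `p` has multiplicity at most `n` at `a`, the real number `a` is also a root of the
    -- twist, whose roots lie strictly above the axis.
    have h2 := him a ((rootMultiplicity_pos ht0).mp (by omega))
    simp at h2

lemma splits_of_aeval_ne_zero {F : ℝ[X]} (hF : ∀ z : ℂ, 0 < z.im → aeval z F ≠ 0) :
    F.Splits := by
  refine Splits.of_splits_map Complex.ofRealHom (IsAlgClosed.splits _) fun a ha => ?_
  have hroot : aeval a F = 0 := by
    rw [← eval_map_ofReal]; exact isRoot_of_mem_roots ha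
  have h1 : ¬ 0 < a.im := fun h => hF a h hroot
  have h2 : ¬ 0 < ((starRingEnd ℂ) a).im := fun h => hF _ h (by rw [aeval_conj, hroot, map_zero])
  rw [Complex.conj_im] at h2
  refine ⟨a.re, ?_⟩
  apply Complex.ext
  · simp
  · simp; linarith

lemma isRoot_map_im {n : ℕ} {P : ℝ[X]} (hP : Hyp n P) {u : ℂ}
    (hu : (P.map Complex.ofRealHom).IsRoot u) : u.im = 0 := by
  obtain ⟨r, rfl⟩ := hP.2.mem_range_of_isRoot hP.ne_zero hu
  simp

/-- Schur-Szegő composition with a polynomial with negative roots preserves hyperbolicity. -/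
theorem hyp_comp {n : ℕ} {P Q : ℝ[X]} (hP : Hyp n P) (hQ : HypNeg n Q) : Hyp n (comp n P Q) := by
  obtain ⟨hd, h0⟩ := comp_natDegree hP.natDegree hP.ne_zero hQ
  refine hyp_of_natDegree h0 hd (splits_of_aeval_ne_zero fun z hz hzero => ?_)
  refine apolar_twist_ne_zero hQ (P.map Complex.ofRealHom) (by simpa using hP.ne_zero)
    (by rw [natDegree_map, hP.natDegree]) (fun u hu => (isRoot_map_im hP hu).le) z hz ?_
  rw [apolar_map_twist hQ.1.natDegree (hQ.coeff_ne_zero (Nat.zero_le n)), eval_map_ofReal, hzero,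
    mul_zero]

/-! ### Hermite–Biehler pairs from moving one root -/

/-- The quotient `F / G` maps the upper half-plane to itself. -/
def HermiteBiehler (F G : ℝ[X]) : Prop :=
  ∀ z : ℂ, 0 < z.im → 0 ≤ (aeval z F * (starRingEnd ℂ) (aeval z G)).im

lemma Hyp.of_X_sub_C_mul {n : ℕ} {P : ℝ[X]} {γ : ℝ} (h : Hyp (n + 1) ((X - C γ) * P)) :
    Hyp n P := by
  have h0 : P ≠ 0 := right_ne_zero_of_mul h.ne_zero
  refine hyp_of_natDegree h0 ?_ (splits_X_sub_C_mul_iff.mp h.2)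
  have := h.natDegree
  rw [natDegree_mul (X_sub_C_ne_zero γ) h0, natDegree_X_sub_C] at this
  omega

lemma Hyp.X_sub_C_mul {n : ℕ} {P : ℝ[X]} (h : Hyp n P) (γ : ℝ) : Hyp (n + 1) ((X - C γ) * P) := by
  refine hyp_of_natDegree (mul_ne_zero (X_sub_C_ne_zero γ) h.ne_zero) ?_
    (splits_X_sub_C_mul_iff.mpr h.2)
  rw [natDegree_mul (X_sub_C_ne_zero γ) h.ne_zero, natDegree_X_sub_C, h.natDegree]; ring

lemma map_X_sub_C_sub (γ : ℝ) (c : ℂ) (P : ℝ[X]) :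
    (X - C ((γ : ℂ) + c)) * P.map Complex.ofRealHom
      = ((X - C γ) * P).map Complex.ofRealHom - C c * P.map Complex.ofRealHom := by
  simp only [Polynomial.map_mul, Polynomial.map_sub, map_X, map_C, C_add,
    Complex.ofRealHom_eq_coe]
  ring

lemma apolar_shifted_root {n : ℕ} {Q : ℝ[X]} (hQ : HypNeg n Q) (P : ℝ[X]) (γ : ℝ) (c z : ℂ) :
    apolar n ((X - C ((γ : ℂ) + c)) * P.map Complex.ofRealHom) (twist Q z)
      = n.factorial * (aeval z (comp n ((X - C γ) * P) Q) - c * aeval z (comp n P Q)) := by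
  have hQ0 := hQ.coeff_ne_zero (Nat.zero_le n)
  rw [map_X_sub_C_sub, apolar_sub_left, apolar_C_mul_left, apolar_map_twist hQ.1.natDegree hQ0,
    apolar_map_twist hQ.1.natDegree hQ0, eval_map_ofReal, eval_map_ofReal]
  ring

lemma isRoot_shifted_im {n : ℕ} {P : ℝ[X]} (hP : Hyp n P) {γ : ℝ} {c u : ℂ} (hc : c.im ≤ 0)
    (hu : ((X - C ((γ : ℂ) + c)) * P.map Complex.ofRealHom).IsRoot u) : u.im ≤ 0 := by
  rw [IsRoot.def, eval_mul, mul_eq_zero] at hu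
  rcases hu with hu | hu
  · have : u = γ + c := by simpa [sub_eq_zero] using hu
    rw [this]; simpa using hc
  · exact (isRoot_map_im hP hu).le

lemma shifted_ne_zero {P : ℝ[X]} (hP : P ≠ 0) (w : ℂ) :
    (X - C w) * P.map Complex.ofRealHom ≠ 0 :=
  mul_ne_zero (X_sub_C_ne_zero w) (by simpa using hP)

lemma shifted_natDegree {n : ℕ} {P : ℝ[X]} (hP : Hyp n P) (w : ℂ) :
    ((X - C w) * P.map Complex.ofRealHom).natDegree = n + 1 := by
  rw [natDegree_mul (X_sub_C_ne_zero w) (by simpa using hP.ne_zero), natDegree_X_sub_C,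
    natDegree_map, hP.natDegree]; ring

/-- If the quotient took a value `c` with `c.im ≤ 0` at `z`, moving the root `γ` to `γ + c` would
give a composition that vanishes at `z`, although the moved root is still outside the open upper
half-plane. -/
lemma hermiteBiehler_comp {n : ℕ} {P Q : ℝ[X]} (hP : Hyp n P) (hQ : HypNeg (n + 1) Q) (γ : ℝ) :
    HermiteBiehler (comp (n + 1) ((X - C γ) * P) Q) (comp (n + 1) P Q) := by
  intro z hz
  by_contra hneg
  push Not at hneg
  set f := aeval z (comp (n + 1) ((X - C γ) * P) Q) with hf
  set g := aeval z (comp (n + 1) P Q) with hg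
  have hg0 : g ≠ 0 := by intro h; rw [h] at hneg; simp at hneg
  have hc : (f / g).im ≤ 0 := by
    have : f / g = f * (starRingEnd ℂ) g * ((Complex.normSq g)⁻¹ : ℝ) := by
      rw [div_eq_mul_inv, Complex.inv_def]; ring
    rw [this, Complex.im_mul_ofReal]
    exact mul_nonpos_of_nonpos_of_nonneg hneg.le (inv_nonneg.mpr (Complex.normSq_nonneg g))
  refine apolar_twist_ne_zero hQ _ (shifted_ne_zero hP.ne_zero ((γ : ℂ) + f / g))
    (shifted_natDegree hP _) (fun u hu => isRoot_shifted_im hP hc hu) z hz ?_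
  rw [apolar_shifted_root hQ, ← hf, ← hg, div_mul_cancel₀ _ hg0, sub_self, mul_zero]

/-- A common zero of the members of the pencil spanned by `P ∗ Q` comes from an A-pair. -/
lemma exists_pair_of_common_zero {n : ℕ} {P Q : ℝ[X]} (hP : Hyp n P) (hQ : HypNeg (n + 1) Q)
    (γ x : ℝ) (hx : x ≠ 0) (hF : (comp (n + 1) ((X - C γ) * P) Q).eval x = 0)
    (hG : (comp (n + 1) P Q).eval x = 0) :
    ∃ a : ℝ, a ≠ 0 ∧ n + 1 < P.rootMultiplicity a + Q.rootMultiplicity (-x / a) := by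
  have hxc : (x : ℂ) ≠ 0 := by exact_mod_cast hx
  -- As both members vanish at `x`, so does the composition for every shift of `γ`. The shift by
  -- `-I` supplies the nonreal root that `apolar_common_root` needs, and this root adds nothing to
  -- multiplicities at real points.
  have hI : (-Complex.I).im ≤ 0 := by simp
  have hp0 := shifted_ne_zero hP.ne_zero ((γ : ℂ) + -Complex.I)
  have ht0 := twist_ne_zero hQ.1.ne_zero x
  have htr : ∀ u, (twist Q x).IsRoot u → u.im = 0 ∧ u ≠ 0 := by
    intro u hu
    obtain ⟨q, hq, rfl⟩ := exists_root_of_twist hQ hxc hu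
    have hqc : (q : ℂ) ≠ 0 := by exact_mod_cast hq.ne
    exact ⟨by rw [Complex.div_ofReal_im]; simp, div_ne_zero (neg_ne_zero.mpr hxc) hqc⟩
  obtain ⟨a, ha⟩ := apolar_common_root (n + 1) 1 _ (twist Q x) hp0 ht0 (shifted_natDegree hP _)
    (twist_natDegree hQ.1.natDegree (hQ.coeff_ne_zero (Nat.zero_le _)) x)
    (fun u hu => by simpa using isRoot_shifted_im hP hI hu)
    (fun u hu => by simp [(htr u hu).1]) one_ne_zero
    (by rw [apolar_shifted_root hQ, aeval_ofReal_eq_eval, aeval_ofReal_eq_eval, hF, hG]; simp)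
    (Or.inl ⟨(γ : ℂ) + -Complex.I, by simp, by simp⟩)
  have hpa : ((X - C ((γ : ℂ) + -Complex.I)) * P.map Complex.ofRealHom).rootMultiplicity (a : ℂ)
      = P.rootMultiplicity a := by
    rw [rootMultiplicity_mul hp0, rootMultiplicity_X_sub_C,
      if_neg (fun h => by simpa using congrArg Complex.im h), zero_add]
    exact (eq_rootMultiplicity_map (f := Complex.ofRealHom) Complex.ofRealHom.injective a).symm
  have hle : P.rootMultiplicity a ≤ n := by
    rw [← count_roots, ← hP.natDegree]
    exact (Multiset.count_le_card _ _).trans (card_roots' P)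
  rw [hpa] at ha
  have ha0 : a ≠ 0 := by
    have := (htr a ((rootMultiplicity_pos ht0).mp (by omega))).2
    exact_mod_cast this
  exact ⟨a, ha0, by rwa [rootMultiplicity_twist hQ.1.ne_zero hx ha0] at ha⟩

/-! ### Multiplicities of the A-roots -/

/-- At `-(α * β)` the twist has a `q`-fold root at `α`, so by `apolar_X_sub_C_pow_mul` the pairing
reduces to `f.eval α` times a nonzero factor. -/
lemma eval_comp_eq_zero_iff {p q : ℕ} {f Q : ℝ[X]} (hf : f.natDegree ≤ q)
    (hQ : Q.natDegree = p + q) (hQ0 : Q.coeff 0 ≠ 0) {α β : ℝ} (hα : α ≠ 0) (hβ : β ≠ 0)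
    (hq : Q.rootMultiplicity β = q) :
    (comp (p + q) ((X - C α) ^ p * f) Q).eval (-(α * β)) = 0 ↔ f.eval α = 0 := by
  have hQne : Q ≠ 0 := by rintro rfl; simp at hQ0
  have hx : -(α * β) ≠ 0 := neg_ne_zero.mpr (mul_ne_zero hα hβ)
  have hmult := rootMultiplicity_twist hQne hx hα
  have e : -(-(α * β)) / α = β := by field_simp
  rw [e, hq] at hmult
  have ht0 := twist_ne_zero hQne ((-(α * β) : ℝ) : ℂ)
  obtain ⟨t, ht, hnd⟩ := exists_eq_pow_rootMultiplicity_mul_and_not_dvd _ ht0 (α : ℂ)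
  rw [hmult] at ht
  have hta : t.eval (α : ℂ) ≠ 0 := fun h => hnd (dvd_iff_isRoot.mpr h)
  have htd : t.natDegree ≤ p := by
    have h1 := twist_natDegree hQ hQ0 ((-(α * β) : ℝ) : ℂ)
    rw [ht] at h1
    have ht00 : t ≠ 0 := by rintro rfl; simp at hta
    rw [natDegree_mul (pow_ne_zero _ (X_sub_C_ne_zero _)) ht00, natDegree_pow,
      natDegree_X_sub_C] at h1
    omega
  have h1 := apolar_map_twist hQ hQ0 ((X - C α) ^ p * f) ((-(α * β) : ℝ) : ℂ)
  have h2 : ((X - C α) ^ p * f).map Complex.ofRealHom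
      = (X - C (α : ℂ)) ^ p * f.map Complex.ofRealHom := by
    simp
  rw [ht, h2, apolar_X_sub_C_pow_mul p q _ _ _ (by rwa [natDegree_map]) htd, eval_map_ofReal,
    eval_map_ofReal, aeval_ofReal_eq_eval, aeval_ofReal_eq_eval] at h1
  have c1 : ((-1 : ℂ) ^ p * (p.factorial * q.factorial)) ≠ 0 := by
    have := p.factorial_ne_zero
    have := q.factorial_ne_zero
    refine mul_ne_zero (pow_ne_zero _ (by simp)) (by exact_mod_cast mul_ne_zero ‹_› ‹_›)
  have c2 : ((p + q).factorial : ℂ) ≠ 0 := by exact_mod_cast (p + q).factorial_ne_zero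
  constructor
  · intro h
    rw [h] at h1
    have : ((f.eval α : ℝ) : ℂ) = 0 := by simpa [c1, hta] using h1
    exact_mod_cast this
  · intro h
    rw [h] at h1
    have : (((comp (p + q) ((X - C α) ^ p * f) Q).eval (-(α * β)) : ℝ) : ℂ) = 0 := by
      simpa [c2] using h1.symm
    exact_mod_cast this

lemma rootMultiplicity_le_natDegree (P : ℝ[X]) (a : ℝ) : P.rootMultiplicity a ≤ P.natDegree := by
  rw [← count_roots]; exact (Multiset.count_le_card _ _).trans (card_roots' P)

/-- The multiplicity of the root of the composition that comes from two roots whose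
multiplicities add up to at least the degree. -/
theorem rootMultiplicity_comp (m : ℕ) : ∀ (n : ℕ) (P Q : ℝ[X]) (α β : ℝ), P ≠ 0 →
    P.natDegree = n → Q.natDegree = n → (∀ i ≤ n, Q.coeff i ≠ 0) → α ≠ 0 → β ≠ 0 →
    P.rootMultiplicity α + Q.rootMultiplicity β = n + m →
    (comp n P Q).rootMultiplicity (-(α * β)) = m := by
  induction m with
  | zero =>
    intro n P Q α β hP0 hP hQ hQc hα hβ hmn
    obtain ⟨f, hf, hnd⟩ := exists_eq_pow_rootMultiplicity_mul_and_not_dvd P hP0 α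
    rw [add_zero] at hmn
    have hf0 : f ≠ 0 := by rintro rfl; simp at hnd
    have hfd : f.natDegree ≤ Q.rootMultiplicity β := by
      have h1 := hP
      rw [hf, natDegree_mul (pow_ne_zero _ (X_sub_C_ne_zero _)) hf0, natDegree_pow,
        natDegree_X_sub_C] at h1
      omega
    refine rootMultiplicity_eq_zero fun h => hnd (dvd_iff_isRoot.mpr ?_)
    rw [IsRoot.def, hf, ← hmn] at h
    exact (eval_comp_eq_zero_iff hfd (by rw [hQ, hmn]) (hQc 0 (Nat.zero_le n)) hα hβ rfl).mp h
  | succ m ih =>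
    intro n P Q α β hP0 hP hQ hQc hα hβ hmn
    have hp : P.rootMultiplicity α ≤ n := hP ▸ rootMultiplicity_le_natDegree P α
    have hq : Q.rootMultiplicity β ≤ n := hQ ▸ rootMultiplicity_le_natDegree Q β
    have hQ0 : Q ≠ 0 := by
      intro h; exact hQc 0 (Nat.zero_le n) (by rw [h, coeff_zero])
    obtain ⟨n, rfl⟩ : ∃ k, n = k + 1 := ⟨n - 1, by omega⟩
    have hPα : P.IsRoot α := (rootMultiplicity_pos hP0).mp (by omega)
    have hQβ : Q.IsRoot β := (rootMultiplicity_pos hQ0).mp (by omega)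
    have hroot : (comp (n + 1) P Q).IsRoot (-(α * β)) := by
      obtain ⟨f, hf⟩ := pow_rootMultiplicity_dvd P α
      set q := Q.rootMultiplicity β with hqdef
      -- Only `p = n + 1 - q` of the factors at `α` are split off; the remaining `m + 1` make the
      -- cofactor vanish at `α`.
      obtain ⟨p, hpq⟩ : ∃ p, n + 1 = p + q := ⟨n + 1 - q, by omega⟩
      have hsplit : P.rootMultiplicity α = p + (m + 1) := by omega
      have hf' : P = (X - C α) ^ p * ((X - C α) ^ (m + 1) * f) := by
        conv_lhs => rw [hf, hsplit, pow_add, mul_assoc]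
      have hg0 : (X - C α) ^ (m + 1) * f ≠ 0 := by
        intro h; rw [h, mul_zero] at hf'; exact hP0 hf'
      have hgd : ((X - C α) ^ (m + 1) * f).natDegree ≤ q := by
        have h1 := hP
        rw [hf', natDegree_mul (pow_ne_zero _ (X_sub_C_ne_zero _)) hg0, natDegree_pow,
          natDegree_X_sub_C] at h1
        omega
      rw [IsRoot.def, hf', hpq]
      exact (eval_comp_eq_zero_iff hgd (by rw [hQ, hpq]) (hQc 0 (Nat.zero_le _)) hα hβ rfl).mpr
        (by simp)
    have hn : ((n : ℝ) + 1) ≠ 0 := by positivity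
    have hd := derivative_comp n P Q
    have hP'0 : derivative P ≠ 0 := by
      intro h; have := derivative_eq_zero.mp h; omega
    have hP' : (derivative P).natDegree = n := by
      rw [natDegree_derivative, hP, Nat.add_sub_cancel]
    have hQ' : (derivative Q).natDegree = n := by
      rw [natDegree_derivative, hQ, Nat.add_sub_cancel]
    -- Differentiation lowers both multiplicities and the degree by one, hence lowers the excess
    -- over the degree by one.
    have hih := ih n (derivative P) (derivative Q) α β hP'0 hP' hQ'
      (fun i hi => by
        rw [coeff_derivative]
        exact mul_ne_zero (hQc (i + 1) (by omega)) (by positivity)) hα hβ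
      (by rw [derivative_rootMultiplicity_of_root hPα, derivative_rootMultiplicity_of_root hQβ]
          have := (rootMultiplicity_pos hP0).mpr hPα
          have := (rootMultiplicity_pos hQ0).mpr hQβ
          omega)
    have hR0 : comp (n + 1) P Q ≠ 0 := by
      intro h
      have h1 := comp_coeff (n + 1) P Q (n + 1)
      rw [h, coeff_zero, Nat.choose_self] at h1
      have h2 : P.coeff (n + 1) ≠ 0 := by rw [← hP]; exact leadingCoeff_ne_zero.mpr hP0
      have h3 := mul_ne_zero h2 (hQc (n + 1) le_rfl)
      simp at h1
      tauto
    have hRpos := (rootMultiplicity_pos hR0).mpr hroot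
    have hR'0 : C ((n : ℝ) + 1) * derivative (comp (n + 1) P Q) ≠ 0 := by
      rw [hd]
      intro h
      have h1 := comp_coeff n (derivative P) (derivative Q) n
      rw [h, coeff_zero, Nat.choose_self, coeff_derivative, coeff_derivative] at h1
      have h2 : P.coeff (n + 1) ≠ 0 := by rw [← hP]; exact leadingCoeff_ne_zero.mpr hP0
      have h3 := hQc (n + 1) le_rfl
      have : ((n : ℝ) + 1) ≠ 0 := hn
      simp [h2, h3, this] at h1
    rw [← hd, rootMultiplicity_mul hR'0, rootMultiplicity_C, zero_add,
      derivative_rootMultiplicity_of_root hroot] at hih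
    omega

/-! ### Monotone motion of roots in a pencil -/

lemma rootsLeft_X_sub_C_mul {F : ℝ[X]} (hF : F ≠ 0) (y x : ℝ) :
    rootsLeft ((X - C y) * F) x = (if y < x then 1 else 0) + rootsLeft F x := by
  rw [rootsLeft, rootsLeft, roots_mul (mul_ne_zero (X_sub_C_ne_zero y) hF), roots_X_sub_C,
    Multiset.countP_add, ← Multiset.cons_zero, Multiset.countP_cons, Multiset.countP_zero, zero_add]

lemma rootsLeft_eq_add {F : ℝ[X]} {x y : ℝ} (hyx : y < x)
    (h : ∀ r ∈ F.roots, ¬(y < r ∧ r < x)) :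
    rootsLeft F x = rootsLeft F y + F.rootMultiplicity y := by
  rw [rootsLeft, rootsLeft, ← count_roots]
  generalize F.roots = s at h
  induction s using Multiset.induction with
  | empty => simp
  | cons a s ih =>
    have ih' := ih fun r hr => h r (Multiset.mem_cons_of_mem hr)
    have ha := h a (Multiset.mem_cons_self _ _)
    rw [Multiset.countP_cons, Multiset.countP_cons, Multiset.count_cons, ih']
    rcases lt_trichotomy a y with h1 | h1 | h1
    · rw [if_pos (h1.trans hyx), if_pos h1, if_neg h1.ne']; ring
    · subst h1; simp [hyx]; ring
    · have h2 : ¬ a < x := fun h2 => ha ⟨h1, h2⟩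
      rw [if_neg h2, if_neg h1.not_gt, if_neg h1.ne]; ring

lemma eval_sign {F : ℝ[X]} (hF : F.Splits) {x : ℝ} (hx : F.eval x ≠ 0) :
    0 < F.eval x * (F.leadingCoeff * (-1) ^ (F.natDegree + rootsLeft F x)) := by
  have hF0 : F ≠ 0 := by rintro rfl; simp at hx
  have hroots : ∀ r ∈ F.roots, r ≠ x := by
    rintro r hr rfl; exact hx (isRoot_of_mem_roots hr)
  rw [hF.eval_eq_prod_roots, hF.natDegree_eq_card_roots, rootsLeft]
  have key : ∀ s : Multiset ℝ, (∀ r ∈ s, r ≠ x) →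
      0 < (s.map fun r => x - r).prod * (-1) ^ (s.card + s.countP (· < x)) := by
    intro s hs
    induction s using Multiset.induction with
    | empty => simp
    | cons a s ih =>
      have ih' := ih fun r hr => hs r (Multiset.mem_cons_of_mem hr)
      have ha := hs a (Multiset.mem_cons_self _ _)
      rw [Multiset.map_cons, Multiset.prod_cons, Multiset.card_cons, Multiset.countP_cons]
      rcases lt_or_gt_of_ne ha with h | h
      · rw [if_pos h]
        have := mul_pos (sub_pos.mpr h) ih'
        ring_nf at this ⊢
        linarith
      · rw [if_neg h.not_gt]
        have := mul_pos (sub_pos.mpr h) ih'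
        ring_nf at this ⊢
        linarith
  have h1 := key F.roots hroots
  have h2 : 0 < F.leadingCoeff * F.leadingCoeff :=
    mul_self_pos.mpr (leadingCoeff_ne_zero.mpr hF0)
  have := mul_pos h2 h1
  linarith

/-- Turns a comparison of signs at a root `y` into the parity of the difference of the two root
counts. The minus sign comes from the linear factor removed from the first polynomial. -/
lemma parity_sign {a B : ℝ[X]} {y : ℝ} (ha : ((X - C y) * a).Splits) (hB : B.Splits)
    (hay : a.eval y ≠ 0) (hBy : B.eval y ≠ 0)
    (hdeg : ((X - C y) * a).natDegree = B.natDegree)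
    (hlead : ((X - C y) * a).leadingCoeff = B.leadingCoeff) :
    0 < -(a.eval y * B.eval y) * (-1) ^ (rootsLeft ((X - C y) * a) y + rootsLeft B y) := by
  have ha0 : a ≠ 0 := by rintro rfl; simp at hay
  have h1 := eval_sign (splits_X_sub_C_mul_iff.mp ha) hay
  have h2 := eval_sign hB hBy
  rw [natDegree_mul (X_sub_C_ne_zero y) ha0, natDegree_X_sub_C] at hdeg
  rw [leadingCoeff_mul, leadingCoeff_X_sub_C, one_mul] at hlead
  rw [rootsLeft_X_sub_C_mul ha0, if_neg (lt_irrefl y), zero_add]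
  rw [← hdeg, ← hlead] at h2
  have h3 := mul_pos h1 h2
  have h4 : 0 < a.leadingCoeff * a.leadingCoeff :=
    mul_self_pos.mpr (leadingCoeff_ne_zero.mpr ha0)
  have e : eval y a * (a.leadingCoeff * (-1) ^ (a.natDegree + rootsLeft a y)) *
      (eval y B * (a.leadingCoeff * (-1) ^ (1 + a.natDegree + rootsLeft B y)))
      = (a.leadingCoeff * a.leadingCoeff) *
        (-(a.eval y * B.eval y) * (-1) ^ (rootsLeft a y + rootsLeft B y)) := by
    have : ((-1 : ℝ) ^ a.natDegree) * (-1) ^ a.natDegree = 1 := by rw [← mul_pow]; simp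
    simp only [pow_add, pow_one]
    linear_combination (-eval y a * a.leadingCoeff * eval y B * a.leadingCoeff *
      (-1) ^ rootsLeft a y * (-1) ^ rootsLeft B y) * this
  rw [e] at h3
  exact pos_of_mul_pos_right h3 h4.le

lemma HermiteBiehler.sub_C_mul {F G : ℝ[X]} (h : HermiteBiehler F G) (t : ℝ) :
    HermiteBiehler (F - C t * G) G := by
  intro z hz
  have h1 := h z hz
  have e : (aeval z (F - C t * G) * (starRingEnd ℂ) (aeval z G)).im
      = (aeval z F * (starRingEnd ℂ) (aeval z G)).im := by
    simp only [map_sub, map_mul, aeval_C, sub_mul, Complex.sub_im, mul_assoc, Complex.mul_conj]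
    simp
  rwa [e]

/-- Boundary behaviour of a Hermite-Biehler pair: the roots of the numerator that are not roots
of the denominator are simple. -/
lemma HermiteBiehler.simple {f G : ℝ[X]} {y : ℝ} {m : ℕ}
    (h : HermiteBiehler ((X - C y) ^ (m + 1) * f) G) (hf : f.eval y ≠ 0) (hG : G.eval y ≠ 0) :
    m = 0 ∧ 0 < f.eval y * G.eval y := by
  -- Approach `y` along the ray of direction `u`, divide by `ρ ^ (m + 1)` and let `ρ` tend to `0`.
  have key : ∀ u : ℂ, 0 < u.im → 0 ≤ (u ^ (m + 1)).im * (f.eval y * G.eval y) := by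
    intro u hu
    let φ : ℝ → ℝ := fun ρ => (u ^ (m + 1) * aeval ((y : ℂ) + ρ * u) f *
      (starRingEnd ℂ) (aeval ((y : ℂ) + ρ * u) G)).im
    have hφ : Continuous φ := by
      refine Complex.continuous_im.comp ?_
      refine (continuous_const.mul ?_).mul (Complex.continuous_conj.comp ?_)
      · exact (Polynomial.continuous_aeval f).comp (by fun_prop)
      · exact (Polynomial.continuous_aeval G).comp (by fun_prop)
    have hpos : ∀ ρ : ℝ, 0 < ρ → 0 ≤ φ ρ := by
      intro ρ hρ
      have h1 := h ((y : ℂ) + ρ * u) (by simpa using mul_pos hρ hu)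
      have e : aeval ((y : ℂ) + ρ * u) ((X - C y) ^ (m + 1) * f) *
          (starRingEnd ℂ) (aeval ((y : ℂ) + ρ * u) G)
          = ((ρ ^ (m + 1) : ℝ) : ℂ) * (u ^ (m + 1) * aeval ((y : ℂ) + ρ * u) f *
            (starRingEnd ℂ) (aeval ((y : ℂ) + ρ * u) G)) := by
        simp only [map_mul, map_pow, map_sub, aeval_X, aeval_C, Complex.coe_algebraMap]
        push_cast
        ring
      rw [e, Complex.im_ofReal_mul] at h1
      exact nonneg_of_mul_nonneg_right h1 (pow_pos hρ _)
    have hlim : Filter.Tendsto φ (nhdsWithin 0 (Set.Ioi 0)) (nhds (φ 0)) :=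
      hφ.continuousAt.continuousWithinAt
    have h0 : 0 ≤ φ 0 := ge_of_tendsto hlim
      (Filter.eventually_of_mem self_mem_nhdsWithin fun ρ hρ => hpos ρ hρ)
    have e0 : φ 0 = (u ^ (m + 1)).im * (f.eval y * G.eval y) := by
      simp only [φ, Complex.ofReal_zero, zero_mul, add_zero, aeval_ofReal_eq_eval, Complex.conj_ofReal]
      rw [Complex.im_mul_ofReal, Complex.im_mul_ofReal]
      ring
    rwa [e0] at h0
  have hne : f.eval y * G.eval y ≠ 0 := mul_ne_zero hf hG
  -- The direction of argument `k * π / (2 * (m + 1))` has power of argument `k * π / 2`. If `m ≥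
  -- 1`, both `k = 1` and `k = 3` are admissible and give opposite signs.
  have hdir : ∀ k : ℝ, 0 < k → k < 2 * ((m : ℝ) + 1) →
      0 ≤ Real.sin (k * (Real.pi / 2)) * (f.eval y * G.eval y) := by
    intro k hk0 hk
    have hm : (0 : ℝ) < (m : ℝ) + 1 := by positivity
    have h1 := key (Complex.exp ((k * (Real.pi / 2) / ((m : ℝ) + 1) : ℝ) * Complex.I)) (by
      rw [Complex.exp_ofReal_mul_I_im]
      refine Real.sin_pos_of_pos_of_lt_pi ?_ ?_
      · have := Real.pi_pos; positivity
      · rw [div_lt_iff₀ hm]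
        nlinarith [Real.pi_pos])
    rw [← Complex.exp_nat_mul] at h1
    have e : ((m + 1 : ℕ) : ℂ) * (((k * (Real.pi / 2) / ((m : ℝ) + 1) : ℝ) : ℂ) * Complex.I)
        = ((k * (Real.pi / 2) : ℝ) : ℂ) * Complex.I := by
      have : ((m : ℂ) + 1) ≠ 0 := by exact_mod_cast hm.ne'
      push_cast
      field_simp
    rwa [e, Complex.exp_ofReal_mul_I_im] at h1
  have h1 := hdir 1 one_pos (by have : (0 : ℝ) ≤ m := Nat.cast_nonneg m; linarith)
  rw [one_mul, Real.sin_pi_div_two, one_mul] at h1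
  refine ⟨?_, lt_of_le_of_ne h1 hne.symm⟩
  by_contra hm
  have hm1 : (1 : ℝ) ≤ m := by exact_mod_cast Nat.one_le_iff_ne_zero.mpr hm
  have h3 := hdir 3 (by norm_num) (by linarith)
  have e3 : Real.sin (3 * (Real.pi / 2)) = -1 := by
    rw [show 3 * (Real.pi / 2) = Real.pi / 2 + Real.pi by ring, Real.sin_add_pi,
      Real.sin_pi_div_two]
  rw [e3] at h3
  exact hne (by linarith)

lemma HermiteBiehler.simple_root {F G : ℝ[X]} (hF0 : F ≠ 0) (h : HermiteBiehler F G) {y : ℝ}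
    (hy : F.eval y = 0) (hG : G.eval y ≠ 0) :
    F.rootMultiplicity y = 1 ∧ ∃ f : ℝ[X], F = (X - C y) * f ∧ 0 < f.eval y * G.eval y := by
  obtain ⟨f, hf, hnd⟩ := exists_eq_pow_rootMultiplicity_mul_and_not_dvd F hF0 y
  have hpos : 0 < F.rootMultiplicity y := (rootMultiplicity_pos hF0).mpr hy
  obtain ⟨m, hm⟩ : ∃ m, F.rootMultiplicity y = m + 1 := ⟨_, (Nat.succ_pred_eq_of_pos hpos).symm⟩
  have hfy : f.eval y ≠ 0 := fun h => hnd (dvd_iff_isRoot.mpr h)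
  rw [hm] at hf
  rw [hf] at h
  obtain ⟨rfl, hp⟩ := h.simple hfy hG
  exact ⟨hm, f, by simpa using hf, hp⟩

/-- The difference of the two counts is even at roots of `F` and odd at roots of `F - C t * G`. All
these roots are simple, so going from left to right the difference alternates between `0` and `1`.
-/
lemma rootsLeft_pencil_of_coprime {F G : ℝ[X]} (hF : F.Splits) (hdeg : G.degree < F.degree)
    (hHB : HermiteBiehler F G) (hcop : ∀ y, F.eval y = 0 → G.eval y ≠ 0) {t : ℝ} (ht : 0 < t)
    (hH : (F - C t * G).Splits) (x : ℝ) :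
    rootsLeft (F - C t * G) x ≤ rootsLeft F x ∧
      rootsLeft F x ≤ rootsLeft (F - C t * G) x + 1 := by
  have hdeg' : (C t * G).degree < F.degree := by rwa [degree_C_mul ht.ne']
  have hF0 : F ≠ 0 := by rintro rfl; simp at hdeg
  set H := F - C t * G with hHdef
  have hHdeg : H.degree = F.degree := degree_sub_eq_left_of_degree_lt hdeg'
  have hHnat : H.natDegree = F.natDegree := natDegree_eq_of_degree_eq hHdeg
  have hHlead : H.leadingCoeff = F.leadingCoeff := leadingCoeff_sub_of_degree_lt hdeg'
  have hH0 : H ≠ 0 := by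
    intro h; rw [h, leadingCoeff_zero] at hHlead; exact hF0 (leadingCoeff_eq_zero.mp hHlead.symm)
  have hHev : ∀ y, H.eval y = F.eval y - t * G.eval y := by intro y; simp [hHdef]
  have hHHB : HermiteBiehler H G := hHB.sub_C_mul t
  have hcopH : ∀ y, H.eval y = 0 → G.eval y ≠ 0 := by
    intro y hy hG
    rw [hHev, hG, mul_zero, sub_zero] at hy
    exact hcop y hy hG
  have hrootF : ∀ y, F.eval y = 0 → F.rootMultiplicity y = 1 ∧ H.rootMultiplicity y = 0 ∧
      Even (rootsLeft F y + rootsLeft H y) := by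
    intro y hy
    have hGy := hcop y hy
    obtain ⟨hm, f, hf, hp⟩ := hHB.simple_root hF0 hy hGy
    have hHy : H.eval y = -t * G.eval y := by rw [hHev, hy]; ring
    have hHy0 : H.eval y ≠ 0 := by rw [hHy]; exact mul_ne_zero (neg_ne_zero.mpr ht.ne') hGy
    have hfy : f.eval y ≠ 0 := left_ne_zero_of_mul hp.ne'
    have hs := parity_sign (hf ▸ hF) hH hfy hHy0 (by rw [← hf, hHnat]) (by rw [← hf, hHlead])
    rw [← hf, hHy] at hs
    refine ⟨hm, rootMultiplicity_eq_zero hHy0, ?_⟩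
    by_contra hodd
    rw [Nat.not_even_iff_odd] at hodd
    rw [hodd.neg_one_pow] at hs
    nlinarith [mul_pos ht hp]
  have hrootH : ∀ y, H.eval y = 0 → H.rootMultiplicity y = 1 ∧ F.rootMultiplicity y = 0 ∧
      Odd (rootsLeft F y + rootsLeft H y) := by
    intro y hy
    have hGy := hcopH y hy
    obtain ⟨hm, f, hf, hp⟩ := hHHB.simple_root hH0 hy hGy
    have hFy : F.eval y = t * G.eval y := by have := hHev y; rw [hy] at this; linarith
    have hFy0 : F.eval y ≠ 0 := by rw [hFy]; exact mul_ne_zero ht.ne' hGy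
    have hfy : f.eval y ≠ 0 := left_ne_zero_of_mul hp.ne'
    have hs := parity_sign (hf ▸ hH) hF hfy hFy0 (by rw [← hf, hHnat]) (by rw [← hf, hHlead])
    rw [← hf, hFy, add_comm] at hs
    refine ⟨hm, rootMultiplicity_eq_zero hFy0, ?_⟩
    by_contra heven
    rw [Nat.not_odd_iff_even] at heven
    rw [heven.neg_one_pow] at hs
    nlinarith [mul_pos ht hp]
  suffices claim : ∀ N x, rootsLeft F x + rootsLeft H x = N →
      rootsLeft H x ≤ rootsLeft F x ∧ rootsLeft F x ≤ rootsLeft H x + 1 from claim _ x rfl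
  intro N
  induction N using Nat.strong_induction_on with
  | _ N ih =>
    intro x hN
    rcases Nat.eq_zero_or_pos N with rfl | hNpos
    · omega
    let T := ((F.roots + H.roots).filter (· < x)).toFinset
    have hT : T.Nonempty := by
      rw [Finset.nonempty_iff_ne_empty]
      intro hempty
      have h0 : (F.roots + H.roots).filter (· < x) = 0 := Multiset.toFinset_eq_empty.mp hempty
      have h1 : (F.roots + H.roots).countP (· < x) = N := by
        rw [Multiset.countP_add]; exact hN
      rw [Multiset.countP_eq_card_filter, h0, Multiset.card_zero] at h1
      omega
    set y := T.max' hT with hy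
    have hyT : y ∈ T := T.max'_mem hT
    have hmemT : ∀ r, r ∈ T ↔ (r ∈ F.roots ∨ r ∈ H.roots) ∧ r < x := by
      intro r; simp only [T, Multiset.mem_toFinset, Multiset.mem_filter, Multiset.mem_add]
    obtain ⟨hyr, hyx⟩ := (hmemT y).mp hyT
    have hgapF : ∀ r ∈ F.roots, ¬(y < r ∧ r < x) := fun r hr hlt =>
      (T.le_max' r ((hmemT r).mpr ⟨Or.inl hr, hlt.2⟩)).not_gt hlt.1
    have hgapH : ∀ r ∈ H.roots, ¬(y < r ∧ r < x) := fun r hr hlt =>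
      (T.le_max' r ((hmemT r).mpr ⟨Or.inr hr, hlt.2⟩)).not_gt hlt.1
    have hFx := rootsLeft_eq_add hyx hgapF
    have hHx := rootsLeft_eq_add hyx hgapH
    rcases hyr with hr | hr
    · obtain ⟨h1, h2, h3⟩ := hrootF y (isRoot_of_mem_roots hr)
      have := ih (rootsLeft F y + rootsLeft H y) (by omega) y rfl
      rw [Nat.even_iff] at h3
      omega
    · obtain ⟨h1, h2, h3⟩ := hrootH y (isRoot_of_mem_roots hr)
      have := ih (rootsLeft F y + rootsLeft H y) (by omega) y rfl
      rw [Nat.odd_iff] at h3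
      omega

/-- In a hyperbolic pencil with the Hermite-Biehler property the roots move monotonically, and
no more than one of them crosses a given point. -/
theorem rootsLeft_pencil (n : ℕ) : ∀ (F G : ℝ[X]), F.natDegree = n → F.Splits →
    G.degree < F.degree → HermiteBiehler F G → ∀ t : ℝ, 0 ≤ t → (F - C t * G).Splits → ∀ x : ℝ,
    rootsLeft (F - C t * G) x ≤ rootsLeft F x ∧
      rootsLeft F x ≤ rootsLeft (F - C t * G) x + 1 := by
  induction n with
  | zero =>
    intro F G hn hF hdeg hHB t ht hH x
    have hF0 : F ≠ 0 := by rintro rfl; simp at hdeg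
    have hG : G = 0 := by
      rw [degree_eq_natDegree hF0, hn] at hdeg
      by_contra hG
      exact (zero_le_degree_iff.mpr hG).not_gt (by exact_mod_cast hdeg)
    simp [hG]
  | succ n ih =>
    intro F G hn hF hdeg hHB t ht hH x
    rcases ht.eq_or_lt with rfl | ht
    · simp
    by_cases hcop : ∀ y, F.eval y = 0 → G.eval y ≠ 0
    · exact rootsLeft_pencil_of_coprime hF hdeg hHB hcop ht hH x
    push Not at hcop
    obtain ⟨y, hFy, hGy⟩ := hcop
    -- A common root is a root of the whole pencil and contributes equally to both counts. Removing
    -- it divides the Hermite–Biehler expression by `|z - y|²`.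
    obtain ⟨F', rfl⟩ := dvd_iff_isRoot.mpr hFy
    obtain ⟨G', rfl⟩ := dvd_iff_isRoot.mpr hGy
    have hF0 : F' ≠ 0 := by rintro rfl; simp at hdeg
    rw [degree_mul, degree_mul] at hdeg
    have hdeg' : G'.degree < F'.degree := by
      by_contra h
      push Not at h
      exact (add_le_add_right h (X - C y).degree).not_gt hdeg
    have e : (X - C y) * F' - C t * ((X - C y) * G') = (X - C y) * (F' - C t * G') := by ring
    have hH0 : F' - C t * G' ≠ 0 := by
      intro h
      rw [sub_eq_zero.mp h, degree_C_mul ht.ne'] at hdeg'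
      exact lt_irrefl _ hdeg'
    rw [e] at hH ⊢
    rw [natDegree_mul (X_sub_C_ne_zero y) hF0, natDegree_X_sub_C] at hn
    have hHB' : HermiteBiehler F' G' := by
      intro z hz
      have h1 := hHB z hz
      have e1 : aeval z ((X - C y) * F') * (starRingEnd ℂ) (aeval z ((X - C y) * G'))
          = ((Complex.normSq (z - y) : ℝ) : ℂ) *
            (aeval z F' * (starRingEnd ℂ) (aeval z G')) := by
        rw [← Complex.mul_conj]
        simp only [map_mul, map_sub, aeval_X, aeval_C, Complex.coe_algebraMap]
        ring
      rw [e1, Complex.im_ofReal_mul] at h1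
      refine nonneg_of_mul_nonneg_right h1 (Complex.normSq_pos.mpr ?_)
      intro h0
      have := congrArg Complex.im h0
      simp at this
      linarith
    have := ih F' G' (by omega) (splits_X_sub_C_mul_iff.mp hF) hdeg' hHB' t ht.le
      (splits_X_sub_C_mul_iff.mp hH) x
    rw [rootsLeft_X_sub_C_mul hF0, rootsLeft_X_sub_C_mul hH0]
    omega

/-! ### Bounds for the position of the roots of the composition -/

lemma rootsLeft_C_mul {a : ℝ} (ha : a ≠ 0) (F : ℝ[X]) (x : ℝ) :
    rootsLeft (C a * F) x = rootsLeft F x := by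
  rw [rootsLeft, rootsLeft, roots_C_mul F ha]

lemma rootsLeft_comp_move {n : ℕ} {P Q : ℝ[X]} (hP : Hyp n P) (hQ : HypNeg (n + 1) Q) {γ γ' : ℝ}
    (hγ : γ ≤ γ') (x : ℝ) :
    rootsLeft (comp (n + 1) ((X - C γ') * P) Q) x ≤ rootsLeft (comp (n + 1) ((X - C γ) * P) Q) x ∧
    rootsLeft (comp (n + 1) ((X - C γ) * P) Q) x
      ≤ rootsLeft (comp (n + 1) ((X - C γ') * P) Q) x + 1 := by
  have hF := hyp_comp (hP.X_sub_C_mul γ) hQ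
  have hF' := hyp_comp (hP.X_sub_C_mul γ') hQ
  have e : comp (n + 1) ((X - C γ') * P) Q
      = comp (n + 1) ((X - C γ) * P) Q - C (γ' - γ) * comp (n + 1) P Q := by
    rw [← comp_C_mul_left, ← comp_sub_left, C_sub]
    congr 1; ring
  have hdeg : (comp (n + 1) P Q).degree < (comp (n + 1) ((X - C γ) * P) Q).degree := by
    rw [hF.1, degree_lt_iff_coeff_zero]
    intro j hj
    rw [comp_coeff, coeff_eq_zero_of_natDegree_lt (by rw [hP.natDegree]; omega)]
    simp
  rw [e] at hF' ⊢
  exact rootsLeft_pencil (n + 1) _ _ hF.natDegree hF.2 hdeg (hermiteBiehler_comp hP hQ γ) _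
    (sub_nonneg.mpr hγ) hF'.2 x

lemma hyp_prod_X_sub_C (s : Multiset ℝ) : Hyp s.card (s.map fun r => X - C r).prod := by
  refine hyp_of_natDegree ?_ (natDegree_multiset_prod_X_sub_C_eq_card s) ?_
  · exact (monic_multiset_prod_of_monic s _ fun r _ => monic_X_sub_C r).ne_zero
  · refine Splits.multisetProd fun f hf => ?_
    obtain ⟨r, -, rfl⟩ := Multiset.mem_map.mp hf
    exact Splits.X_sub_C r

/-- The roots of the first factor are moved to `α` one at a time. A root below `α` moves right and
costs at most one; any other root moves left or stays, which cannot lower the count. -/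
lemma rootsLeft_comp_prod_le {n : ℕ} {Q : ℝ[X]} (hQ : HypNeg n Q) (α x : ℝ) (s : Multiset ℝ) :
    ∀ k : ℕ, s.card + k = n →
    rootsLeft (comp n ((s.map fun r => X - C r).prod * (X - C α) ^ k) Q) x
      ≤ s.countP (· < α) + rootsLeft (comp n ((X - C α) ^ n) Q) x := by
  induction s using Multiset.induction with
  | empty =>
    intro k hk
    have : k = n := by simpa using hk
    simp [this]
  | cons a s ih =>
    intro k hk
    rw [Multiset.card_cons] at hk
    obtain ⟨n, rfl⟩ : ∃ m, n = m + 1 := ⟨n - 1, by omega⟩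
    have hP1 : Hyp n ((s.map fun r => X - C r).prod * (X - C α) ^ k) := by
      have h := hyp_prod_X_sub_C (s + Multiset.replicate k α)
      rw [Multiset.map_add, Multiset.prod_add, Multiset.map_replicate, Multiset.prod_replicate,
        Multiset.card_add, Multiset.card_replicate] at h
      rwa [show s.card + k = n by omega] at h
    have ih' := ih (k + 1) (by omega)
    have e1 : (s.map fun r => X - C r).prod * (X - C α) ^ (k + 1)
        = (X - C α) * ((s.map fun r => X - C r).prod * (X - C α) ^ k) := by ring
    rw [e1] at ih'
    rw [Multiset.map_cons, Multiset.prod_cons, mul_assoc, Multiset.countP_cons]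
    rcases lt_or_ge a α with h | h
    · have := (rootsLeft_comp_move hP1 hQ h.le x).2
      rw [if_pos h]; omega
    · have := (rootsLeft_comp_move hP1 hQ h x).1
      rw [if_neg h.not_gt]; omega

/-- The end of the motion, where all roots sit at `α`: the binomial coefficients cancel and only a
dilation of `Q` remains. -/
lemma comp_X_sub_C_pow {n : ℕ} {Q : ℝ[X]} (hQ : Q.natDegree = n) (α : ℝ) :
    comp n ((X - C α) ^ n) Q = Q.scaleRoots (-α) := by
  ext i
  rw [comp_coeff, coeff_scaleRoots, hQ, sub_eq_add_neg, ← C_neg, coeff_X_add_C_pow]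
  rcases Nat.lt_or_ge n i with h | h
  · rw [Nat.choose_eq_zero_of_lt h, coeff_eq_zero_of_natDegree_lt (by omega)]; simp
  · have : (n.choose i : ℝ) ≠ 0 := by exact_mod_cast (Nat.choose_pos h).ne'
    field_simp

/-- The dilation by `-α` reverses the order exactly when `α > 0`. At `α = 0` it gives a multiple of
a power of `X`, with no root left of `0`, in accordance with the default value of `rootsSide`. -/
lemma rootsLeft_scaleRoots {Q : ℝ[X]} (hQ : Q ≠ 0) (α β : ℝ) :
    rootsLeft (Q.scaleRoots (-α)) (-(α * β)) = rootsSide Q (SignType.sign α) β := by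
  rcases lt_trichotomy α 0 with h | rfl | h
  · rw [sign_neg h, rootsLeft, roots_scaleRoots _ (IsUnit.mk0 _ (neg_ne_zero.mpr h.ne)),
      Multiset.countP_map, ← Multiset.countP_eq_card_filter]
    refine Multiset.countP_congr rfl fun q _ => ?_
    have : -α * q < -(α * β) ↔ q < β := by
      rw [← neg_mul, mul_lt_mul_iff_right₀ (neg_pos.mpr h)]
    simpa using this
  · rw [sign_zero, neg_zero, zero_mul, neg_zero, scaleRoots_zero, rootsLeft, smul_eq_C_mul,
      roots_C_mul _ (leadingCoeff_ne_zero.mpr hQ), roots_X_pow]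
    rw [Multiset.countP_nsmul]
    simp [rootsSide, ← Multiset.cons_zero]
  · rw [sign_pos h, rootsLeft, roots_scaleRoots _ (IsUnit.mk0 _ (neg_ne_zero.mpr h.ne')),
      Multiset.countP_map, ← Multiset.countP_eq_card_filter]
    refine Multiset.countP_congr rfl fun q _ => ?_
    have : -α * q < -(α * β) ↔ β < q := by
      rw [neg_mul, neg_lt_neg_iff, mul_lt_mul_iff_right₀ h]
    simpa using this

/-- An upper bound for the number of roots of the composition to the left of `-αβ`. -/
theorem rootsLeft_comp_le {n : ℕ} {P Q : ℝ[X]} (hP : Hyp n P) (hQ : HypNeg n Q) (α β : ℝ) :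
    rootsLeft (comp n P Q) (-(α * β)) ≤ rootsLeft P α + rootsSide Q (SignType.sign α) β := by
  have h := rootsLeft_comp_prod_le hQ α (-(α * β)) P.roots 0 (by rw [hP.card_roots, add_zero])
  rw [pow_zero, mul_one, comp_X_sub_C_pow hQ.1.natDegree, rootsLeft_scaleRoots hQ.1.ne_zero] at h
  have hl := leadingCoeff_ne_zero.mpr hP.ne_zero
  conv_lhs => rw [hP.2.eq_prod_roots, comp_C_mul_left, rootsLeft_C_mul hl]
  exact h

lemma roots_comp_neg_X {P : ℝ[X]} (hP : P.Splits) :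
    (P.comp (-X)).roots = P.roots.map fun r => -r := by
  rcases eq_or_ne P 0 with rfl | hP0
  · simp
  have key : ∀ s : Multiset ℝ, ((s.map fun r => X - C r).prod).comp (-X)
      = C ((-1) ^ s.card) * ((s.map fun r => -r).map fun r => X - C r).prod := by
    intro s
    induction s using Multiset.induction with
    | empty => simp
    | cons a s ih =>
      simp only [Multiset.map_cons, Multiset.prod_cons, mul_comp, ih, Multiset.card_cons, pow_succ,
        C_mul, sub_comp, X_comp, C_comp, C_neg, C_1]
      ring
  conv_lhs => rw [hP.eq_prod_roots]
  rw [mul_comp, C_comp, key, ← mul_assoc, ← C_mul, roots_C_mul, roots_multiset_prod_X_sub_C]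
  exact mul_ne_zero (leadingCoeff_ne_zero.mpr hP0) (pow_ne_zero _ (by norm_num))

lemma rootsLeft_comp_neg_X {P : ℝ[X]} (hP : P.Splits) (x : ℝ) :
    rootsLeft (P.comp (-X)) (-x) = rootsRight P x := by
  rw [rootsLeft, rootsRight, roots_comp_neg_X hP, Multiset.countP_map,
    ← Multiset.countP_eq_card_filter]
  exact Multiset.countP_congr rfl fun q _ => by simp

lemma Hyp.comp_neg_X {n : ℕ} {P : ℝ[X]} (hP : Hyp n P) : Hyp n (P.comp (-X)) := by
  have hd : (P.comp (-X)).natDegree = n := by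
    rw [natDegree_comp, natDegree_neg, natDegree_X, hP.natDegree, mul_one]
  refine hyp_of_natDegree ?_ hd hP.2.comp_neg_X
  intro h
  have h1 := coeff_comp_neg_X P n
  rw [h, coeff_zero] at h1
  have h2 : P.coeff n ≠ 0 := by
    rw [← hP.natDegree]; exact leadingCoeff_ne_zero.mpr hP.ne_zero
  exact mul_ne_zero h2 (pow_ne_zero n (by norm_num)) h1.symm

/-- An upper bound for the number of roots of the composition to the right of `-αβ`. -/
theorem rootsRight_comp_le {n : ℕ} {P Q : ℝ[X]} (hP : Hyp n P) (hQ : HypNeg n Q) (α β : ℝ) :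
    rootsRight (comp n P Q) (-(α * β)) ≤ rootsRight P α + rootsSide Q (SignType.sign (-α)) β := by
  have h := rootsLeft_comp_le hP.comp_neg_X hQ (-α) β
  rwa [comp_comp_neg_X, neg_mul, rootsLeft_comp_neg_X (hyp_comp hP hQ).2,
    rootsLeft_comp_neg_X hP.2] at h

/-! ### A-pairs and the rules for the composition -/

lemma countP_lt_add_count_add_countP_gt (s : Multiset ℝ) (x : ℝ) :
    s.countP (· < x) + s.count x + s.countP (x < ·) = s.card := by
  induction s using Multiset.induction with
  | empty => simp
  | cons a s ih =>
    rw [Multiset.countP_cons, Multiset.countP_cons, Multiset.count_cons, Multiset.card_cons]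
    rcases lt_trichotomy a x with h | h | h
    · rw [if_pos h, if_neg h.not_gt, if_neg h.ne']; omega
    · subst h; simp; omega
    · rw [if_pos h, if_neg h.not_gt, if_neg h.ne]; omega

lemma Hyp.rootsLeft_add {n : ℕ} {P : ℝ[X]} (hP : Hyp n P) (x : ℝ) :
    rootsLeft P x + P.rootMultiplicity x + rootsRight P x = n := by
  rw [← count_roots, rootsLeft, rootsRight, countP_lt_add_count_add_countP_gt, hP.card_roots]

lemma Hyp.rootMultiplicity_add_le {n : ℕ} {P : ℝ[X]} (hP : Hyp n P) {a b : ℝ} (hab : a ≠ b) :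
    P.rootMultiplicity a + P.rootMultiplicity b ≤ n := by
  rw [← hP.card_roots, ← count_roots, ← count_roots]
  induction P.roots using Multiset.induction with
  | empty => simp
  | cons c s ih =>
    rw [Multiset.count_cons, Multiset.count_cons, Multiset.card_cons]
    split_ifs with h1 h2
    · exact absurd (h1.trans h2.symm) hab
    all_goals omega

lemma isAPair_iff {n : ℕ} {P Q : ℝ[X]} (hP : Hyp n P) (hQ : Hyp n Q) {α β : ℝ} :
    IsAPair n P Q α β ↔ n < P.rootMultiplicity α + Q.rootMultiplicity β := by
  refine ⟨fun h => h.2.2, fun h => ?_⟩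
  have h1 : P.rootMultiplicity α ≤ n := hP.natDegree ▸ rootMultiplicity_le_natDegree P α
  have h2 : Q.rootMultiplicity β ≤ n := hQ.natDegree ▸ rootMultiplicity_le_natDegree Q β
  exact ⟨(rootMultiplicity_pos hP.ne_zero).mp (by omega),
    (rootMultiplicity_pos hQ.ne_zero).mp (by omega), h⟩

/-- If both partners were different from `β` and `α`, the four multiplicities would add up to more
than `2 * n`, while two distinct roots of one polynomial account for at most `n`. -/
lemma isAPair_of_isARoot {n : ℕ} {P Q : ℝ[X]} (hP : Hyp n P) (hQ : Hyp n Q) {α β : ℝ}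
    (hα : IsARootFst n P Q α) (hβ : IsARootSnd n P Q β) : IsAPair n P Q α β := by
  obtain ⟨β', h1⟩ := hα
  obtain ⟨α', h2⟩ := hβ
  by_cases e1 : β' = β
  · exact e1 ▸ h1
  by_cases e2 : α' = α
  · exact e2 ▸ h2
  have := hP.rootMultiplicity_add_le e2
  have := hQ.rootMultiplicity_add_le e1
  have := h1.2.2
  have := h2.2.2
  omega

lemma rootsSide_add {n : ℕ} {Q : ℝ[X]} (hQ : Hyp n Q) {α : ℝ} (hα : α ≠ 0) (β : ℝ) :
    rootsSide Q (SignType.sign α) β + Q.rootMultiplicity β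
      + rootsSide Q (SignType.sign (-α)) β = n := by
  have := hQ.rootsLeft_add β
  rcases lt_or_gt_of_ne hα with h | h
  · rw [sign_neg h, sign_pos (neg_pos.mpr h)]
    exact this
  · rw [sign_pos h, sign_neg (neg_lt_zero.mpr h)]
    simp only [rootsSide]; omega

/-- The coefficients of `Q` do not vanish, so the composition has the same support as `P`. -/
lemma rootMultiplicity_zero_comp {n : ℕ} {P Q : ℝ[X]} (hP : Hyp n P) (hQ : HypNeg n Q) :
    (comp n P Q).rootMultiplicity 0 = P.rootMultiplicity 0 := by
  rw [rootMultiplicity_eq_natTrailingDegree', rootMultiplicity_eq_natTrailingDegree']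
  have hsupp : (comp n P Q).support = P.support := by
    ext i
    rw [mem_support_iff, mem_support_iff, comp_coeff]
    rcases Nat.lt_or_ge n i with h | h
    · rw [coeff_eq_zero_of_natDegree_lt (by rw [hP.natDegree]; exact h)]; simp
    · have h1 : (n.choose i : ℝ) ≠ 0 := by exact_mod_cast (Nat.choose_pos h).ne'
      have h2 := hQ.coeff_ne_zero h
      simp [h1, h2]
  rw [natTrailingDegree, natTrailingDegree, trailingDegree, trailingDegree, hsupp]

/-- Split off any root `γ` of `P`. Either the root `x` is shared with the composition of the
cofactor, which gives an A-pair, or the Hermite–Biehler property makes it simple. -/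
lemma simple_of_isBRoot {n : ℕ} {P Q : ℝ[X]} (hP : Hyp n P) (hQ : HypNeg n Q) {x : ℝ}
    (hx : IsBRoot n P Q (comp n P Q) x) : (comp n P Q).rootMultiplicity x = 1 := by
  obtain ⟨hroot, hloc⟩ := hx
  have hR := hyp_comp hP hQ
  have hx0 : x ≠ 0 := by
    rintro rfl
    refine hloc (Or.inr ⟨rfl, ?_⟩)
    rw [← rootMultiplicity_pos hP.ne_zero, ← rootMultiplicity_zero_comp hP hQ]
    exact (rootMultiplicity_pos hR.ne_zero).mpr hroot
  have hn : n ≠ 0 := by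
    rintro rfl
    have h1 := (rootMultiplicity_pos hR.ne_zero).mpr hroot
    have h2 := rootMultiplicity_le_natDegree (comp 0 P Q) x
    rw [hR.natDegree] at h2
    omega
  obtain ⟨γ, hγ⟩ := hP.2.exists_eval_eq_zero (by rw [hP.1]; exact_mod_cast hn)
  obtain ⟨n, rfl⟩ := Nat.exists_eq_succ_of_ne_zero hn
  obtain ⟨P₁, rfl⟩ := dvd_iff_isRoot.mpr hγ
  have hP1 := hP.of_X_sub_C_mul
  by_cases hG : (comp (n + 1) P₁ Q).eval x = 0
  · exfalso
    obtain ⟨a, ha, hlt⟩ := exists_pair_of_common_zero hP1 hQ γ x hx0 hroot hG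
    refine hloc (Or.inl ⟨a, -x / a, (isAPair_iff hP hQ.1).mpr ?_, by field_simp⟩)
    rw [rootMultiplicity_mul hP.ne_zero]
    show n + 1 < _
    omega
  · exact ((hermiteBiehler_comp hP1 hQ γ).simple_root hR.ne_zero hroot hG).1

theorem rules_comp {n : ℕ} {P Q : ℝ[X]} (hP : Hyp n P) (hQ : HypNeg n Q) :
    Rules n P Q (comp n P Q) := by
  have hR := hyp_comp hP hQ
  have hmult : ∀ α β : ℝ, α ≠ 0 → IsAPair n P Q α β →
      (comp n P Q).rootMultiplicity (-(α * β)) + n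
        = P.rootMultiplicity α + Q.rootMultiplicity β := by
    intro α β hα h
    obtain ⟨m, hm⟩ := Nat.exists_eq_add_of_le h.2.2.le
    rw [rootMultiplicity_comp m n P Q α β hP.ne_zero hP.natDegree hQ.1.natDegree
      (fun i hi => hQ.coeff_ne_zero hi) hα (hQ.2 β h.2.1).ne hm, hm, add_comm]
  refine ⟨?_, hmult, ?_, fun x hx => simple_of_isBRoot hP hQ hx⟩
  · rintro u v w ⟨-, rfl, rfl, rfl⟩
    -- At `α = 0` the contribution of `Q` is zero; the bounds on both sides and the multiplicity at
    -- `0` add up to `n`, so they are sharp.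
    have h1 := rootsLeft_comp_le hP hQ 0 0
    have h2 := rootsRight_comp_le hP hQ 0 0
    have h3 := rootMultiplicity_zero_comp hP hQ
    have h4 := hP.rootsLeft_add 0
    have h5 := hR.rootsLeft_add 0
    simp only [mul_zero, neg_zero, sign_zero] at h1 h2
    have h6 : rootsSide Q 0 0 = 0 := rfl
    exact ⟨hR, by omega, h3, by omega⟩
  · intro α β hα h1 h2
    have hpair := isAPair_of_isARoot hP hQ.1 h1 h2
    have h3 := hmult α β hα hpair
    have h4 := rootsLeft_comp_le hP hQ α β
    have h5 := rootsRight_comp_le hP hQ α β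
    have h6 := hR.rootsLeft_add (-(α * β))
    have h7 := hP.rootsLeft_add α
    have h8 := rootsSide_add hQ.1 hα β
    -- The two upper bounds add up to `2 * n` minus both multiplicities, which is `n` minus the
    -- multiplicity of `-(α * β)`; hence both are equalities.
    omega

/-! ### Encoding multiplicity vectors by blocks -/

/-- The blocks of equal roots of a polynomial: the pairs of the number of roots to the left of a
root and its multiplicity. -/
def blocks (R : ℝ[X]) : Set (ℕ × ℕ) :=
  {b | ∃ x, R.IsRoot x ∧ b = (rootsLeft R x, R.rootMultiplicity x)}

/-- The pairs of a partial sum of a list (started at `k`) and the entry that follows. -/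
def listBlocks : ℕ → List ℕ → Set (ℕ × ℕ)
  | _, [] => ∅
  | k, a :: t => insert (k, a) (listBlocks (k + a) t)

lemma le_of_mem_listBlocks {l : List ℕ} : ∀ {k : ℕ} {b : ℕ × ℕ}, b ∈ listBlocks k l → k ≤ b.1 := by
  induction l with
  | nil => intro k b hb; exact absurd hb (Set.notMem_empty b)
  | cons a t ih =>
    intro k b hb
    rcases hb with rfl | hb
    · exact le_rfl
    · have := ih hb; omega

/-- Positivity of the entries makes the head the only pair with first component `k`, so it can be
read off and removed. -/
lemma listBlocks_injective {l : List ℕ} : ∀ {l' : List ℕ} {k : ℕ}, (∀ a ∈ l, 0 < a) →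
    (∀ a ∈ l', 0 < a) → listBlocks k l = listBlocks k l' → l = l' := by
  induction l with
  | nil =>
    intro l' k _ _ h
    cases l' with
    | nil => rfl
    | cons a t => exact absurd (h ▸ Set.mem_insert (k, a) _ : (k, a) ∈ listBlocks k []) id
  | cons a t ih =>
    intro l' k hl hl' h
    cases l' with
    | nil => exact absurd (h ▸ Set.mem_insert (k, a) _ : (k, a) ∈ listBlocks k []) id
    | cons a' t' =>
      have ha := hl a List.mem_cons_self
      have ha' := hl' a' List.mem_cons_self
      have hmem : (k, a) ∈ listBlocks k (a' :: t') := h ▸ Set.mem_insert (k, a) _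
      have haa : a = a' := by
        rcases hmem with hm | hm
        · exact (Prod.mk.inj hm).2
        · have := le_of_mem_listBlocks hm; simp at this; omega
      subst haa
      have htt : listBlocks (k + a) t = listBlocks (k + a) t' := by
        have h1 : (k, a) ∉ listBlocks (k + a) t := fun hm => by
          have := le_of_mem_listBlocks hm; simp at this; omega
        have h2 : (k, a) ∉ listBlocks (k + a) t' := fun hm => by
          have := le_of_mem_listBlocks hm; simp at this; omega
        have h3 : insert (k, a) (listBlocks (k + a) t) = insert (k, a) (listBlocks (k + a) t') := h
        rw [← Set.insert_sdiff_self_of_notMem h1, h3, Set.insert_sdiff_self_of_notMem h2]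
      rw [ih (fun b hb => hl b (List.mem_cons_of_mem _ hb))
        (fun b hb => hl' b (List.mem_cons_of_mem _ hb)) htt]

lemma listBlocks_map (m : ℝ → ℕ) {l : List ℝ} (hl : l.Pairwise (· < ·)) : ∀ k : ℕ,
    listBlocks k (l.map m)
      = {b | ∃ x ∈ l, b = (k + ((l.filter fun y => y < x).map m).sum, m x)} := by
  induction l with
  | nil => intro k; simp [listBlocks]
  | cons a t ih =>
    intro k
    rw [List.pairwise_cons] at hl
    rw [List.map_cons, listBlocks, ih hl.2]
    have hnone : (t.filter fun y => y < a) = [] := by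
      rw [List.filter_eq_nil_iff]
      intro y hy
      simpa using (hl.1 y hy).le
    ext b
    simp only [Set.mem_insert_iff, Set.mem_ofPred_eq, List.mem_cons, exists_eq_or_imp]
    refine or_congr ?_ (exists_congr fun x => and_congr_right fun hx => ?_)
    · simp [hnone]
    · simp [hl.1 x hx, add_assoc]

lemma rootsLeft_eq_sum (R : ℝ[X]) (x : ℝ) :
    rootsLeft R x = (((R.roots.toFinset.sort (· ≤ ·)).filter fun y => y < x).map
      fun y => R.rootMultiplicity y).sum := by
  have hnd : ((R.roots.toFinset.sort (· ≤ ·)).filter fun y => y < x).Nodup :=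
    (Finset.sort_nodup _ _).filter _
  rw [← List.sum_toFinset _ hnd, List.toFinset_filter, Finset.sort_toFinset, rootsLeft,
    Multiset.countP_eq_card_filter, ← Multiset.toFinset_sum_count_eq, Multiset.toFinset_filter]
  refine Finset.sum_congr (by ext; simp) fun y hy => ?_
  rw [Multiset.count_filter, count_roots, if_pos]
  simpa using (Finset.mem_filter.mp hy).2

lemma blocks_eq_listBlocks {R : ℝ[X]} (hR : R ≠ 0) : blocks R = listBlocks 0 (multVector R) := by
  have hs : (R.roots.toFinset.sort (· ≤ ·)).Pairwise (· < ·) := Finset.sortedLT_sort _ |>.pairwise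
  rw [multVector, listBlocks_map _ hs]
  ext b
  simp only [blocks, Set.mem_ofPred_eq]
  refine exists_congr fun x => ?_
  rw [rootsLeft_eq_sum, zero_add, Finset.mem_sort, Multiset.mem_toFinset, mem_roots hR]

lemma multVector_pos {R : ℝ[X]} (hR : R ≠ 0) : ∀ a ∈ multVector R, 0 < a := by
  intro a ha
  obtain ⟨x, hx, rfl⟩ := List.mem_map.mp ha
  rw [Finset.mem_sort, Multiset.mem_toFinset, mem_roots hR] at hx
  exact (rootMultiplicity_pos hR).mpr hx

lemma multVector_eq_of_blocks_eq {R R' : ℝ[X]} (hR : R ≠ 0) (hR' : R' ≠ 0)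
    (h : blocks R = blocks R') : multVector R = multVector R' := by
  rw [blocks_eq_listBlocks hR, blocks_eq_listBlocks hR'] at h
  exact listBlocks_injective (multVector_pos hR) (multVector_pos hR') h

/-! ### The rules determine the blocks -/

/-- The blocks of the A-roots of the composition, in terms of the blocks of the factors and of
the numbers `u` and `v` of negative and zero roots of the first factor. -/
def locationBlocks (n u v : ℕ) (B C : Set (ℕ × ℕ)) : Set (ℕ × ℕ) :=
  {b | (∃ i p j q, (i, p) ∈ B ∧ (j, q) ∈ C ∧ p + q = n + b.2 ∧ 0 < b.2 ∧
    -- The first alternative is a negative root of the first factor, the second a positive one,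
    -- where `n - j - q` roots of the second factor lie to the right. A root at `0` has `i = u` and
    -- satisfies neither.
    ((i < u ∧ b.1 = i + j) ∨ (u + v ≤ i ∧ b.1 + j + q = i + n))) ∨ (0 < v ∧ b = (u, v))}

/-- The blocks of the composition. -/
def compositionBlocks (n u v : ℕ) (B C : Set (ℕ × ℕ)) : Set (ℕ × ℕ) :=
  locationBlocks n u v B C ∪
    -- Each rank not covered by an A-root is a simple B-root.
    {b | b.2 = 1 ∧ b.1 < n ∧ ∀ c ∈ locationBlocks n u v B C, ¬(c.1 ≤ b.1 ∧ b.1 < c.1 + c.2)}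

lemma rootsLeft_add_le {F : ℝ[X]} {x y : ℝ} (h : x < y) :
    rootsLeft F x + F.rootMultiplicity x ≤ rootsLeft F y := by
  rw [rootsLeft, rootsLeft, ← count_roots]
  induction F.roots using Multiset.induction with
  | empty => simp
  | cons a s ih =>
    rw [Multiset.countP_cons, Multiset.countP_cons, Multiset.count_cons]
    rcases lt_trichotomy a x with h1 | h1 | h1
    · rw [if_pos h1, if_pos (h1.trans h), if_neg h1.ne']; omega
    · subst h1; simp [h]; omega
    · rw [if_neg h1.not_gt, if_neg h1.ne]; split_ifs <;> omega

lemma rootsLeft_mono (F : ℝ[X]) {x y : ℝ} (h : x ≤ y) : rootsLeft F x ≤ rootsLeft F y := by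
  rcases h.eq_or_lt with rfl | h
  · exact le_rfl
  · have := rootsLeft_add_le (F := F) h; omega

lemma eq_of_rootsLeft_overlap {F : ℝ[X]} {x y : ℝ} {k : ℕ}
    (hx : rootsLeft F x ≤ k ∧ k < rootsLeft F x + F.rootMultiplicity x)
    (hy : rootsLeft F y ≤ k ∧ k < rootsLeft F y + F.rootMultiplicity y) : x = y := by
  rcases lt_trichotomy x y with h | h | h
  · have := rootsLeft_add_le (F := F) h; omega
  · exact h
  · have := rootsLeft_add_le (F := F) h; omega

/-- The blocks cover all ranks below `n`: take the last root with at most `k` roots to its left. If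
its block ended at or before rank `k`, the next root would qualify too. -/
lemma Hyp.exists_root_at {n : ℕ} {F : ℝ[X]} (hF : Hyp n F) {k : ℕ} (hk : k < n) :
    ∃ x, F.IsRoot x ∧ rootsLeft F x ≤ k ∧ k < rootsLeft F x + F.rootMultiplicity x := by
  have hne : F.roots.toFinset.Nonempty := by
    rw [Finset.nonempty_iff_ne_empty, Ne, Multiset.toFinset_eq_empty]
    intro h
    have := hF.card_roots
    rw [h, Multiset.card_zero] at this
    omega
  let T := F.roots.toFinset.filter fun x => rootsLeft F x ≤ k
  have hT : T.Nonempty := by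
    refine ⟨F.roots.toFinset.min' hne, Finset.mem_filter.mpr ⟨Finset.min'_mem _ _, ?_⟩⟩
    rw [rootsLeft, Multiset.countP_eq_zero.mpr]
    · exact Nat.zero_le k
    · intro a ha
      exact (Finset.min'_le _ a (Multiset.mem_toFinset.mpr ha)).not_gt
  set x := T.max' hT with hx
  have hxT : x ∈ T := T.max'_mem hT
  obtain ⟨hxr, hxk⟩ := Finset.mem_filter.mp hxT
  refine ⟨x, isRoot_of_mem_roots (Multiset.mem_toFinset.mp hxr), hxk, ?_⟩
  by_contra hle
  push Not at hle
  let U := F.roots.toFinset.filter fun y => x < y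
  have hadd := hF.rootsLeft_add x
  have hU : U.Nonempty := by
    have : 0 < rootsRight F x := by omega
    obtain ⟨a, ha, hxa⟩ := Multiset.countP_pos.mp this
    exact ⟨a, Finset.mem_filter.mpr ⟨Multiset.mem_toFinset.mpr ha, hxa⟩⟩
  obtain ⟨y, hyU, hmin⟩ : ∃ y ∈ U, ∀ z ∈ U, y ≤ z := ⟨_, U.min'_mem hU, fun z hz => U.min'_le z hz⟩
  obtain ⟨hyr, hxy⟩ := Finset.mem_filter.mp hyU
  have hgap : ∀ r ∈ F.roots, ¬(x < r ∧ r < y) := fun r hr hlt =>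
    (hmin r (Finset.mem_filter.mpr ⟨Multiset.mem_toFinset.mpr hr, hlt.1⟩)).not_gt hlt.2
  have hyk := rootsLeft_eq_add hxy hgap
  have hyT : y ∈ T := Finset.mem_filter.mpr ⟨hyr, by omega⟩
  exact (T.le_max' y hyT).not_gt hxy

lemma mem_locationBlocks_iff {n u v w : ℕ} {P Q R : ℝ[X]} (hP : MemH n u v w P)
    (hQ : HypNeg n Q) (hR : Rules n P Q R) (b : ℕ × ℕ) :
    b ∈ locationBlocks n u v (blocks P) (blocks Q) ↔
      ∃ x, R.IsRoot x ∧ IsALocation n P Q x ∧ b = (rootsLeft R x, R.rootMultiplicity x) := by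
  obtain ⟨hRH, hRu, hRv, -⟩ := hR.signs u v w hP
  obtain ⟨hPH, hPu, hPv, -⟩ := hP
  constructor
  · rintro (⟨i, p, j, q, ⟨α, hα, hi⟩, ⟨β, hβ, hj⟩, hpq, hb, hside⟩ | ⟨hv, rfl⟩)
    · obtain ⟨rfl, rfl⟩ := Prod.mk.inj hi
      obtain ⟨rfl, rfl⟩ := Prod.mk.inj hj
      have hpair : IsAPair n P Q α β := ⟨hα, hβ, by omega⟩
      have hαpos := (rootMultiplicity_pos hPH.ne_zero).mpr hα
      have hsign : α ≠ 0 := by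
        -- At `α = 0` the index is `u` and `v` is positive, which excludes both alternatives of
        -- `hside`.
        rintro rfl; omega
      have hm := hR.mult α β hsign hpair
      have hpos := hR.position α β hsign ⟨β, hpair⟩ ⟨α, hpair⟩
      refine ⟨-(α * β), (rootMultiplicity_pos hRH.ne_zero).mp (by omega),
        Or.inl ⟨α, β, hpair, rfl⟩, Prod.ext ?_ (by simp only; omega)⟩
      rw [hpos]
      have hadd := hQ.1.rootsLeft_add β
      rcases lt_or_gt_of_ne hsign with h | h
      · rw [sign_neg h]
        have := rootsLeft_add_le (F := P) h
        rcases hside with ⟨-, h1⟩ | ⟨h1, -⟩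
        · exact h1
        · omega
      · rw [sign_pos h]
        have := rootsLeft_mono P h.le
        rcases hside with ⟨h1, -⟩ | ⟨-, h1⟩
        · omega
        · simp only [rootsSide]; omega
    · refine ⟨0, (rootMultiplicity_pos hRH.ne_zero).mp (by omega), Or.inr ⟨rfl, ?_⟩, by
        rw [hRu, hRv]⟩
      exact (rootMultiplicity_pos hPH.ne_zero).mp (by omega)
  · rintro ⟨x, hx, hloc, rfl⟩
    by_cases hx0 : x = 0
    · subst hx0
      have := (rootMultiplicity_pos hRH.ne_zero).mpr hx
      exact Or.inr ⟨by omega, by rw [hRu, hRv]⟩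
    · obtain ⟨α, β, hpair, rfl⟩ : ∃ α β : ℝ, IsAPair n P Q α β ∧ x = -(α * β) := by
        rcases hloc with h | h
        · exact h
        · exact absurd h.1 hx0
      have hsign : α ≠ 0 := by rintro rfl; simp at hx0
      have hm := hR.mult α β hsign hpair
      have hpos := hR.position α β hsign ⟨β, hpair⟩ ⟨α, hpair⟩
      have hadd := hQ.1.rootsLeft_add β
      have hαpos := (rootMultiplicity_pos hPH.ne_zero).mpr hpair.1
      refine Or.inl ⟨_, _, _, _, ⟨α, hpair.1, rfl⟩, ⟨β, hpair.2.1, rfl⟩, ?_, ?_, ?_⟩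
      · simp only; omega
      · exact (rootMultiplicity_pos hRH.ne_zero).mpr hx
      · simp only [hpos]
        rcases lt_or_gt_of_ne hsign with h | h
        · rw [sign_neg h]
          have := rootsLeft_add_le (F := P) h
          exact Or.inl ⟨by omega, rfl⟩
        · rw [sign_pos h]
          have := rootsLeft_add_le (F := P) h
          refine Or.inr ⟨by omega, ?_⟩
          simp only [rootsSide]; omega

/-- The rules determine the blocks. -/
theorem blocks_of_rules {n u v w : ℕ} {P Q R : ℝ[X]} (hP : MemH n u v w P)
    (hQ : HypNeg n Q) (hR : Rules n P Q R) :
    blocks R = compositionBlocks n u v (blocks P) (blocks Q) := by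
  have hRH := (hR.signs u v w hP).1
  have hloc := mem_locationBlocks_iff hP hQ hR
  ext b
  constructor
  · rintro ⟨x, hx, rfl⟩
    by_cases hxl : IsALocation n P Q x
    · exact Or.inl ((hloc _).mpr ⟨x, hx, hxl, rfl⟩)
    · have h1 := hR.simple x ⟨hx, hxl⟩
      have hadd := hRH.rootsLeft_add x
      refine Or.inr ⟨h1, by simp only; omega, ?_⟩
      intro c hc hcov
      obtain ⟨y, -, hyl, rfl⟩ := (hloc c).mp hc
      have := eq_of_rootsLeft_overlap (F := R) (x := x) (y := y) (k := rootsLeft R x)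
        ⟨le_rfl, by omega⟩ hcov
      exact hxl (this ▸ hyl)
  · rintro (hb | ⟨h1, h2, h3⟩)
    · obtain ⟨x, hx, -, rfl⟩ := (hloc b).mp hb
      exact ⟨x, hx, rfl⟩
    · obtain ⟨x, hx, hk⟩ := hRH.exists_root_at h2
      have hxl : ¬IsALocation n P Q x := fun hxl =>
        h3 _ ((hloc _).mpr ⟨x, hx, hxl, rfl⟩) hk
      have hm := hR.simple x ⟨hx, hxl⟩
      refine ⟨x, hx, Prod.ext ?_ ?_⟩
      · simp only; omega
      · simp only; omega

end

end SchurSzego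

theorem theorem3 (n : ℕ) (P Q : Polynomial ℝ)
    (hP : SchurSzego.Hyp n P) (hQ : SchurSzego.HypNeg n Q) :
    -- the composition obeys the rules
    SchurSzego.Rules n P Q (SchurSzego.comp n P Q) ∧
    -- the rules determine the multiplicity vector
    (∀ R : Polynomial ℝ, SchurSzego.Rules n P Q R →
      SchurSzego.multVector R = SchurSzego.multVector (SchurSzego.comp n P Q)) ∧
    -- it depends only on the multiplicity vectors and on the root signs of the factors
    (∀ (P' Q' : Polynomial ℝ) (u v w : ℕ),
      SchurSzego.MemH n u v w P → SchurSzego.MemH n u v w P' → SchurSzego.HypNeg n Q' →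
      SchurSzego.multVector P' = SchurSzego.multVector P →
      SchurSzego.multVector Q' = SchurSzego.multVector Q →
      SchurSzego.multVector (SchurSzego.comp n P' Q') =
        SchurSzego.multVector (SchurSzego.comp n P Q)) := by
  have hrules := SchurSzego.rules_comp hP hQ
  have hcomp := SchurSzego.hyp_comp hP hQ
  refine ⟨hrules, fun R hR => ?_, fun P' Q' u v w hPm hPm' hQ' hMP hMQ => ?_⟩
  · have hPm : SchurSzego.MemH n _ _ _ P := ⟨hP, rfl, rfl, rfl⟩
    refine SchurSzego.multVector_eq_of_blocks_eq (hR.signs _ _ _ hPm).1.ne_zero hcomp.ne_zero ?_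
    rw [SchurSzego.blocks_of_rules hPm hQ hR, SchurSzego.blocks_of_rules hPm hQ hrules]
  · have hrules' := SchurSzego.rules_comp hPm'.1 hQ'
    refine SchurSzego.multVector_eq_of_blocks_eq (SchurSzego.hyp_comp hPm'.1 hQ').ne_zero
      hcomp.ne_zero ?_
    rw [SchurSzego.blocks_of_rules hPm' hQ' hrules', SchurSzego.blocks_of_rules hPm hQ hrules,
      SchurSzego.blocks_eq_listBlocks hPm'.1.ne_zero, SchurSzego.blocks_eq_listBlocks hP.ne_zero,
      SchurSzego.blocks_eq_listBlocks hQ'.1.ne_zero, SchurSzego.blocks_eq_listBlocks hQ.1.ne_zero,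
      hMP, hMQ]
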